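/- Let $1<p<\infty$. Let $\mathcal{D}=\{([0,1)+j)\cdot 2^k : j,k\in\mathbb{Z}\}$ be the standard dyadic lattice on $\mathbb{R}$, write $|I|$ for the Lebesgue measure of $I$ and $\langle f\rangle_I$ for the average of $f$ over $I$. For $I\in\mathcal{D}$ and real numbers $F,\mathbf{f},M,C\ge 0$ let $$\mathcal{B}(F,\mathbf{f},M;C)=\sup\Big\{|I|^{-1}\sum_{J\in\mathcal{D},\,J\subseteq I}\alpha_J\langle f\rangle_J^p\Big\},$$ the supremum being taken over all measurable functions $f\ge 0$ on $\mathbb{R}$ and all families $\{\alpha_J\}_{J\in\mathcal{D}}$ of non-negative numbers such that $\langle f^p\rangle_I=F$, $\langle f\rangle_I=\mathbf{f}$, $|I|^{-1}\sum_{J\in\mathcal{D},\,J\subseteq I}\alpha_J=M$, and $\sum_{J'\in\mathcal{D},\,J'\subseteq J}\alpha_{J'}\le C|J|$ for all $J\in\mathcal{D}$. Let $(\mathcal{X},\mathcal{F},\{\mathcal{F}_n\}_{n\ge 0},\mu)$ be a discrete-time filtered probability space with $\{\emptyset,\mathcal{X}\}=\mathcal{F}_0\subseteq\mathcal{F}_1\subseteq\dots\subseteq\mathcal{F}$,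 and write $f_n=\mathbb{E}^\mu[f\mid\mathcal{F}_n]$. Let $$\mathcal{B}_\mu^{\mathcal{F}}(F,\mathbf{f},M;C)=\sup\Big\{\mathbb{E}^\mu\Big[\sum_{n\ge 0}\alpha_n f_n^p\Big]\Big\},$$ the supremum being taken over all $\mathcal{F}$-measurable functions $f\ge 0$ and all sequences $\{\alpha_n\}_{n\ge 0}$ of non-negative random variables, with $\alpha_n$ being $\mathcal{F}_n$-measurable, such that $\mathbb{E}^\mu[f^p]=F$, $\mathbb{E}^\mu[f]=\mathbf{f}$, $\mathbb{E}^\mu[\sum_{n\ge 0}\alpha_n]=M$, and $\mathbb{E}^\mu[\sum_{k\ge n}\alpha_k\mid\mathcal{F}_n]\le C$ almost surely for every $n\ge 0$. Both suprema are taken in $[0,\infty]$, and $\sup\emptyset=0$. Then, for every $I\in\mathcal{D}$ and all $F,\mathbf{f},M,C\ge 0$, $$\mathcal{B}_\mu^{\mathcal{F}}(F,\mathbf{f},M;C)\le\mathcal{B}(F,\mathbf{f},M;C).$$ Moreover, if $\{\mathcal{F}_n\}_{n\ge 0}$ is infinitely refining, that is, if for every $\varepsilon>0$, every $n\ge 0$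 and every $E\in\mathcal{F}_n$ there are $k>n$ and a real-valued integrable $\mathcal{F}_k$-measurable random variable $h$ with $|h\mathbf{1}_E|=\mathbf{1}_E$ and $\int_E|h_n|\,d\mu\le\varepsilon$, where $h_n=\mathbb{E}^\mu[h\mid\mathcal{F}_n]$, then for every $I\in\mathcal{D}$ and all $F,\mathbf{f},M,C\ge 0$ $$\mathcal{B}_\mu^{\mathcal{F}}(F,\mathbf{f},M;C)=\mathcal{B}(F,\mathbf{f},M;C).$$ -/

import Mathlib

open MeasureTheory
open scoped NNReal ENNReal

namespace CarlesonBellman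

noncomputable section

/-- The dyadic interval `([0,1) + j) * 2^k`, where `J = (k, j)`. Distinct pairs give distinct
intervals, so that families indexed by the standard dyadic lattice are families indexed
by `ℤ × ℤ`. -/
def dyadicInterval (J : ℤ × ℤ) : Set ℝ :=
  Set.Ico ((J.2 : ℝ) * 2 ^ J.1) (((J.2 : ℝ) + 1) * 2 ^ J.1)

/-- `∑_{J ∈ 𝒟, J ⊆ I} a_J`, as an element of `[0, ∞]`. -/
def sumBelow (a : ℤ × ℤ → ℝ≥0∞) (I : ℤ × ℤ) : ℝ≥0∞ :=
  ∑' J : {J : ℤ × ℤ // dyadicInterval J ⊆ dyadicInterval I}, a J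

/-- The Carleson condition with constant `C` for a family of non-negative numbers indexed by the
dyadic lattice: `∑_{J' ⊆ J} α_{J'} ≤ C |J|` for all dyadic `J`. -/
def DyadicCarleson (C : ℝ≥0) (α : ℤ × ℤ → ℝ≥0) : Prop :=
  ∀ J : ℤ × ℤ, sumBelow (fun J' => (α J' : ℝ≥0∞)) J ≤ C * volume (dyadicInterval J)

/-- The average `⟨g⟩_J` over the dyadic interval `J` of a function with values in `[0, ∞]`. -/
def dyadicAverage (g : ℝ → ℝ≥0∞) (J : ℤ × ℤ) : ℝ≥0∞ :=
  ⨍⁻ x in dyadicInterval J, g x ∂volume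

/-- The Bellman function of the dyadic Carleson embedding theorem, on the dyadic interval `I`, at
the point `(F, t, M; C)`. The supremum is taken in `[0, ∞]`. -/
def dyadicBellman (p : ℝ) (I : ℤ × ℤ) (F t M C : ℝ≥0) : ℝ≥0∞ :=
  sSup {v : ℝ≥0∞ | ∃ (f : ℝ → ℝ≥0) (α : ℤ × ℤ → ℝ≥0),
    Measurable f ∧
    dyadicAverage (fun x => (f x : ℝ≥0∞) ^ p) I = F ∧
    dyadicAverage (fun x => (f x : ℝ≥0∞)) I = t ∧
    (volume (dyadicInterval I))⁻¹ * sumBelow (fun J => (α J : ℝ≥0∞)) I = M ∧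
    DyadicCarleson C α ∧
    v = (volume (dyadicInterval I))⁻¹ *
      sumBelow (fun J => (α J : ℝ≥0∞) * dyadicAverage (fun x => (f x : ℝ≥0∞)) J ^ p) I}

variable {X : Type*} {m : MeasurableSpace X}

/-- Carleson sequences of non-negative random variables: `α n` is `ℱ n`-measurable and
`E[∑_{k ≥ n} α k | ℱ n] ≤ C` almost surely, for every `n`. -/
def IsCarlesonSequence (μ : Measure X) (ℱ : Filtration ℕ m) (C : ℝ≥0) (α : ℕ → X → ℝ≥0) : Prop :=
  (∀ n, Measurable[ℱ n] (α n)) ∧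
  ∀ n, ∀ᵐ x ∂μ, (μ⁻[fun y => ∑' k : ℕ, (α (n + k) y : ℝ≥0∞) | ℱ n]) x ≤ C

/-- The Bellman function of the martingale Carleson embedding theorem at the point
`(F, t, M; C)`. The supremum is taken in `[0, ∞]`. -/
def martingaleBellman (μ : Measure X) (ℱ : Filtration ℕ m) (p : ℝ) (F t M C : ℝ≥0) : ℝ≥0∞ :=
  sSup {v : ℝ≥0∞ | ∃ (f : X → ℝ≥0) (α : ℕ → X → ℝ≥0),
    Measurable f ∧
    ∫⁻ x, (f x : ℝ≥0∞) ^ p ∂μ = F ∧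
    ∫⁻ x, (f x : ℝ≥0∞) ∂μ = t ∧
    ∫⁻ x, ∑' n : ℕ, (α n x : ℝ≥0∞) ∂μ = M ∧
    IsCarlesonSequence μ ℱ C α ∧
    v = ∫⁻ x, ∑' n : ℕ, (α n x : ℝ≥0∞) * (μ⁻[fun y => (f y : ℝ≥0∞) | ℱ n]) x ^ p ∂μ}

/-- Infinitely refining filtrations: for all `ε > 0`, `n` and `E ∈ ℱ n` there are `k > n` and a
real `ℱ k`-measurable random variable `h` (integrable, so that its conditional expectation
makes sense) with `|h 1_E| = 1_E` and `∫_E |E[h | ℱ n]| dμ ≤ ε`. -/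
def IsInfinitelyRefining (μ : Measure X) (ℱ : Filtration ℕ m) : Prop :=
  ∀ ε : ℝ, 0 < ε → ∀ (n : ℕ) (E : Set X), MeasurableSet[ℱ n] E →
    ∃ k : ℕ, n < k ∧ ∃ h : X → ℝ, Measurable[ℱ k] h ∧ Integrable h μ ∧
      (∀ x, |E.indicator h x| = E.indicator (fun _ => (1 : ℝ)) x) ∧
      ∫ x in E, |(μ[h | ℱ n]) x| ∂μ ≤ ε

end

end CarlesonBellman

/-! Upper bound. Gluing admissible pairs on the two halves of a dyadic interval and placing an extra
weight on the interval itself shows that the dyadic Bellman function is midpoint concave in `(F, t,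
M)` and grows by at least `a * t ^ p` when `M` grows by `a` (`infBellman_midpoint`,
`infBellman_jump`). A non-negative midpoint concave function is concave
(`concave_of_midpoint_concave`), so its perspective is superadditive. Evaluated at the mass of a set
and at the integrals over it, the perspective gives a superadditive set function on each `ℱ n`
(`bellmanFunctional`). To absorb the term `α n * f_n ^ p`, cut the set into level sets of `f_n` on
which `f_n` varies by a factor of at most `r`. There `f_n` may be replaced by its average at the
cost of `r ^ p`, and the jump inequality passes from `n` to `n + 1`. Induction on the number of
terms, followed by `r → 1`, finishes the estimate (`setLIntegral_sum_le_bellmanFunctional`).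

Lower bound. A dyadic pair is copied into the filtration. Each halving of an interval becomes a
splitting of a set `E` of `ℱ n` into two sets of a later `ℱ k`
(`IsInfinitelyRefining.exists_split`), the intervals below a cutoff scale become constants, and the
weight of an interval becomes a constant on its set (`Approximable.node`, `approximable_of_dyadic`).
The splitting is only approximately conditionally even, which would spoil the Carleson condition, so
the weights on the pieces are multiplied by an `ℱ n`-measurable `w ≤ 1` that restores it exactly.
The loss is small because the functions are bounded by a constant fixed before the accuracy is
chosen. All other errors are collected in `δ`.

It remains to attain the prescribed integrals exactly. If `t ^ p < F`, scale the approximant by `θ <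
1` and use the room gained to increase it until both integrals are correct
(`exists_ge_lintegral_eq`). A constant added to `α 0` corrects the mass. Then `δ → 0` and `θ → 1`.
If `t ^ p = F`, equality in Jensen's inequality makes the dyadic function constant, and a constant
function on the probability space does as well. -/

namespace CarlesonBellman

/-! ### Geometry of the dyadic lattice -/

/-- The left half of a dyadic interval. -/
def leftChild (J : ℤ × ℤ) : ℤ × ℤ := (J.1 - 1, 2 * J.2)

/-- The right half of a dyadic interval. -/
def rightChild (J : ℤ × ℤ) : ℤ × ℤ := (J.1 - 1, 2 * J.2 + 1)

/-- The length of a dyadic interval. -/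
noncomputable def dyadicLength (J : ℤ × ℤ) : ℝ≥0 := 2 ^ J.1

lemma dyadicLength_pos (J : ℤ × ℤ) : 0 < dyadicLength J := by
  unfold dyadicLength; positivity

lemma volume_dyadicInterval (J : ℤ × ℤ) : volume (dyadicInterval J) = dyadicLength J := by
  rw [dyadicInterval, Real.volume_Ico, ENNReal.ofReal, dyadicLength]
  congr 1
  have : ((J.2 : ℝ) + 1) * 2 ^ J.1 - J.2 * 2 ^ J.1 = 2 ^ J.1 := by ring
  rw [this]
  ext
  rw [Real.coe_toNNReal _ (by positivity)]
  simp

lemma measurableSet_dyadicInterval (J : ℤ × ℤ) : MeasurableSet (dyadicInterval J) :=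
  measurableSet_Ico

lemma left_mem_dyadicInterval (J : ℤ × ℤ) : (J.2 : ℝ) * 2 ^ J.1 ∈ dyadicInterval J := by
  have : (0 : ℝ) < 2 ^ J.1 := by positivity
  exact ⟨le_rfl, by nlinarith⟩

lemma two_mul_dyadicLength_leftChild (J : ℤ × ℤ) :
    2 * dyadicLength (leftChild J) = dyadicLength J := by
  simp only [dyadicLength, leftChild]
  rw [zpow_sub_one₀ (by norm_num)]
  field_simp

lemma dyadicInterval_eq_union (J : ℤ × ℤ) :
    dyadicInterval J = dyadicInterval (leftChild J) ∪ dyadicInterval (rightChild J) := by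
  have h2 : (2 : ℝ) ^ J.1 = 2 * 2 ^ (J.1 - 1) := by
    rw [zpow_sub_one₀ (by norm_num)]; field_simp
  have hp : (0 : ℝ) < 2 ^ (J.1 - 1) := by positivity
  simp only [dyadicInterval, leftChild, rightChild]
  push_cast
  rw [Set.Ico_union_Ico_eq_Ico (by nlinarith) (by nlinarith), h2]
  congr 1 <;> ring

lemma disjoint_children (J : ℤ × ℤ) :
    Disjoint (dyadicInterval (leftChild J)) (dyadicInterval (rightChild J)) := by
  simp only [dyadicInterval, leftChild, rightChild]
  push_cast
  exact Set.Ico_disjoint_Ico_same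

lemma leftChild_subset (J : ℤ × ℤ) : dyadicInterval (leftChild J) ⊆ dyadicInterval J := by
  rw [dyadicInterval_eq_union J]; exact Set.subset_union_left

lemma rightChild_subset (J : ℤ × ℤ) : dyadicInterval (rightChild J) ⊆ dyadicInterval J := by
  rw [dyadicInterval_eq_union J]; exact Set.subset_union_right

/-- Of two dyadic intervals that meet, the shorter is contained in the longer. -/
lemma dyadicInterval_subset_of_mem {J K : ℤ × ℤ} (h : J.1 ≤ K.1) {x : ℝ}
    (hJ : x ∈ dyadicInterval J) (hK : x ∈ dyadicInterval K) :
    dyadicInterval J ⊆ dyadicInterval K := by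
  obtain ⟨d, hd⟩ := Int.le.dest h
  have hp : (0 : ℝ) < 2 ^ J.1 := by positivity
  have hK1 : (2 : ℝ) ^ K.1 = ((2 ^ d : ℤ) : ℝ) * 2 ^ J.1 := by
    rw [← hd, zpow_add₀ (by norm_num)]; push_cast; rw [zpow_natCast]; ring
  simp only [dyadicInterval, Set.mem_Ico] at hJ hK
  rw [hK1, ← mul_assoc, ← mul_assoc] at hK
  have h1 : J.2 < (K.2 + 1) * 2 ^ d := by
    have := (mul_lt_mul_iff_left₀ hp).1 (hJ.1.trans_lt hK.2)
    exact_mod_cast this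
  have h2 : K.2 * 2 ^ d < J.2 + 1 := by
    have := (mul_lt_mul_iff_left₀ hp).1 (hK.1.trans_lt hJ.2)
    exact_mod_cast this
  have h1' : (J.2 : ℝ) + 1 ≤ (K.2 + 1) * ((2 ^ d : ℤ) : ℝ) := by exact_mod_cast h1
  have h2' : (K.2 : ℝ) * ((2 ^ d : ℤ) : ℝ) ≤ J.2 := by exact_mod_cast Int.lt_add_one_iff.1 h2
  apply Set.Ico_subset_Ico
  · rw [hK1, ← mul_assoc]; gcongr
  · rw [hK1, ← mul_assoc]; gcongr

lemma fst_le_of_subset {J K : ℤ × ℤ} (h : dyadicInterval J ⊆ dyadicInterval K) : J.1 ≤ K.1 := by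
  have := measure_mono (μ := volume) h
  rw [volume_dyadicInterval, volume_dyadicInterval, ENNReal.coe_le_coe] at this
  exact (zpow_le_zpow_iff_right₀ (by norm_num)).1 this

lemma dyadicInterval_injective : Function.Injective dyadicInterval := by
  intro J K h
  have h1 : J.1 = K.1 := le_antisymm (fst_le_of_subset h.le) (fst_le_of_subset h.ge)
  have hp : (0 : ℝ) < 2 ^ J.1 := by positivity
  have h2 : (K.2 : ℝ) * 2 ^ K.1 ≤ J.2 * 2 ^ J.1 := (h ▸ left_mem_dyadicInterval J).1
  have h3 : (J.2 : ℝ) * 2 ^ J.1 ≤ K.2 * 2 ^ K.1 := (h.symm ▸ left_mem_dyadicInterval K).1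
  rw [← h1] at h2 h3
  have h4 := le_antisymm ((mul_le_mul_iff_left₀ hp).1 h3) ((mul_le_mul_iff_left₀ hp).1 h2)
  exact Prod.ext h1 (by exact_mod_cast h4)

lemma subset_iff_eq_or_subset_child {J K : ℤ × ℤ} : dyadicInterval J ⊆ dyadicInterval K ↔
    J = K ∨ dyadicInterval J ⊆ dyadicInterval (leftChild K) ∨
      dyadicInterval J ⊆ dyadicInterval (rightChild K) := by
  constructor
  · intro h
    rcases (fst_le_of_subset h).lt_or_eq with hlt | heq
    · right
      have hx := h (left_mem_dyadicInterval J)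
      rw [dyadicInterval_eq_union K] at hx
      rcases hx with hx | hx
      · exact .inl (dyadicInterval_subset_of_mem (Int.le_sub_one_of_lt hlt)
          (left_mem_dyadicInterval J) hx)
      · exact .inr (dyadicInterval_subset_of_mem (Int.le_sub_one_of_lt hlt)
          (left_mem_dyadicInterval J) hx)
    · left
      have := dyadicInterval_subset_of_mem heq.ge (h (left_mem_dyadicInterval J))
        (left_mem_dyadicInterval J)
      exact dyadicInterval_injective (h.antisymm this)
  · rintro (rfl | h | h)
    · exact subset_rfl
    · exact h.trans (leftChild_subset K)
    · exact h.trans (rightChild_subset K)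

lemma not_subset_leftChild (J : ℤ × ℤ) : ¬ dyadicInterval J ⊆ dyadicInterval (leftChild J) :=
  fun h => by have := fst_le_of_subset h; simp [leftChild] at this

lemma not_subset_rightChild (J : ℤ × ℤ) : ¬ dyadicInterval J ⊆ dyadicInterval (rightChild J) :=
  fun h => by have := fst_le_of_subset h; simp [rightChild] at this

lemma not_subset_both {J K : ℤ × ℤ} (h1 : dyadicInterval J ⊆ dyadicInterval (leftChild K))
    (h2 : dyadicInterval J ⊆ dyadicInterval (rightChild K)) : False := by
  have hx := left_mem_dyadicInterval J
  exact Set.disjoint_left.1 (disjoint_children K) (h1 hx) (h2 hx)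

/-! ### Dyadic sums and averages, and their recursion over the two halves -/

open Classical in
lemma sumBelow_eq_tsum (a : ℤ × ℤ → ℝ≥0∞) (I : ℤ × ℤ) :
    sumBelow a I = ∑' J, if dyadicInterval J ⊆ dyadicInterval I then a J else 0 := by
  refine (tsum_subtype {J | dyadicInterval J ⊆ dyadicInterval I} a).trans (tsum_congr fun J => ?_)
  simp [Set.indicator_apply]

lemma sumBelow_eq_children (a : ℤ × ℤ → ℝ≥0∞) (I : ℤ × ℤ) :
    sumBelow a I = a I + (sumBelow a (leftChild I) + sumBelow a (rightChild I)) := by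
  classical
  simp only [sumBelow_eq_tsum]
  rw [← ENNReal.tsum_add, ← tsum_ite_eq I a, ← ENNReal.tsum_add]
  refine tsum_congr fun J => ?_
  by_cases h0 : J = I
  · subst h0
    simp [not_subset_leftChild, not_subset_rightChild]
  by_cases h1 : dyadicInterval J ⊆ dyadicInterval (leftChild I)
  · have h2 : ¬ dyadicInterval J ⊆ dyadicInterval (rightChild I) := not_subset_both h1
    simp [h0, h1, h2, h1.trans (leftChild_subset I)]
  · by_cases h2 : dyadicInterval J ⊆ dyadicInterval (rightChild I)
    · simp [h0, h1, h2, h2.trans (rightChild_subset I)]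
    · have : ¬ dyadicInterval J ⊆ dyadicInterval I := by
        rw [subset_iff_eq_or_subset_child]; tauto
      simp [h0, h1, h2, this]

lemma sumBelow_congr {a b : ℤ × ℤ → ℝ≥0∞} {I : ℤ × ℤ}
    (h : ∀ J, dyadicInterval J ⊆ dyadicInterval I → a J = b J) : sumBelow a I = sumBelow b I :=
  tsum_congr fun J => h J.1 J.2

lemma dyadicAverage_eq (g : ℝ → ℝ≥0∞) (J : ℤ × ℤ) :
    dyadicAverage g J = (dyadicLength J : ℝ≥0∞)⁻¹ * ∫⁻ x in dyadicInterval J, g x := by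
  rw [dyadicAverage, setLAverage_eq, volume_dyadicInterval, ENNReal.div_eq_inv_mul]

lemma dyadicAverage_congr {g h : ℝ → ℝ≥0∞} {J : ℤ × ℤ} (H : ∀ x ∈ dyadicInterval J, g x = h x) :
    dyadicAverage g J = dyadicAverage h J := by
  rw [dyadicAverage_eq, dyadicAverage_eq,
    setLIntegral_congr_fun (measurableSet_dyadicInterval J) H]

lemma coe_dyadicLength_ne_zero (J : ℤ × ℤ) : (dyadicLength J : ℝ≥0∞) ≠ 0 := by
  simpa using (dyadicLength_pos J).ne'

lemma inv_dyadicLength_mul_add (I : ℤ × ℤ) (x y : ℝ≥0∞) :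
    (dyadicLength I : ℝ≥0∞)⁻¹ * (x + y) =
      (2 : ℝ≥0∞)⁻¹ * ((dyadicLength (leftChild I) : ℝ≥0∞)⁻¹ * x +
        (dyadicLength (rightChild I) : ℝ≥0∞)⁻¹ * y) := by
  have h1 : (dyadicLength I : ℝ≥0∞)⁻¹ =
      (2 : ℝ≥0∞)⁻¹ * (dyadicLength (leftChild I) : ℝ≥0∞)⁻¹ := by
    rw [← two_mul_dyadicLength_leftChild, ENNReal.coe_mul, ENNReal.mul_inv] <;> simp
  have h2 : dyadicLength (rightChild I) = dyadicLength (leftChild I) := rfl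
  rw [h1, h2]; ring

lemma dyadicAverage_eq_children (g : ℝ → ℝ≥0∞) (I : ℤ × ℤ) :
    dyadicAverage g I =
      (2 : ℝ≥0∞)⁻¹ * (dyadicAverage g (leftChild I) + dyadicAverage g (rightChild I)) := by
  simp only [dyadicAverage_eq]
  rw [← inv_dyadicLength_mul_add, dyadicInterval_eq_union I,
    lintegral_union (measurableSet_dyadicInterval _) (disjoint_children I)]

lemma normalized_sumBelow_eq_children (a : ℤ × ℤ → ℝ≥0∞) (I : ℤ × ℤ) :
    (dyadicLength I : ℝ≥0∞)⁻¹ * sumBelow a I = (dyadicLength I : ℝ≥0∞)⁻¹ * a I +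
      (2 : ℝ≥0∞)⁻¹ * ((dyadicLength (leftChild I) : ℝ≥0∞)⁻¹ * sumBelow a (leftChild I) +
        (dyadicLength (rightChild I) : ℝ≥0∞)⁻¹ * sumBelow a (rightChild I)) := by
  rw [sumBelow_eq_children, mul_add, ← inv_dyadicLength_mul_add]

lemma inv_two_mul_coe_add (x y : ℝ≥0) :
    (2 : ℝ≥0∞)⁻¹ * ((x : ℝ≥0∞) + y) = (((x + y) / 2 : ℝ≥0) : ℝ≥0∞) := by
  rw [ENNReal.coe_div (by norm_num), ENNReal.div_eq_inv_mul]; simp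

/-! ### From midpoint concavity to concavity -/

/-- A non-negative midpoint concave function, possibly taking the value `∞`, is concave. -/
lemma concave_of_midpoint_concave {E : Type*} [AddCommMonoid E] [Module ℝ≥0 E] {S : Set E}
    (hS : ∀ x ∈ S, ∀ y ∈ S, ∀ a b : ℝ≥0, a + b = 1 → a • x + b • y ∈ S) {g : E → ℝ≥0∞}
    (hg : ∀ x ∈ S, ∀ y ∈ S,
      (2 : ℝ≥0∞)⁻¹ * (g x + g y) ≤ g ((2⁻¹ : ℝ≥0) • x + (2⁻¹ : ℝ≥0) • y))
    {x y : E} (hx : x ∈ S) (hy : y ∈ S) {a b : ℝ≥0} (hab : a + b = 1) :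
    a * g x + b * g y ≤ g (a • x + b • y) := by
  -- Each point of the segment is the midpoint of an endpoint, the one of weight at least one half,
  -- and another point of the segment. Hence the error in the concavity inequality halves at each
  -- step. It starts at no more than `u + v` because `g ≥ 0`, so no regularity of `g` is needed. The
  -- finite `u`, `v` stand in for values that may be infinite.
  have key : ∀ (u v : ℝ≥0), (u : ℝ≥0∞) ≤ g x → (v : ℝ≥0∞) ≤ g y → ∀ (n : ℕ) (a b : ℝ≥0), a + b = 1 →
      ((a * u + b * v : ℝ≥0) : ℝ≥0∞) ≤
        g (a • x + b • y) + (((2⁻¹ : ℝ≥0) ^ n * (u + v) : ℝ≥0) : ℝ≥0∞) := by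
    intro u v hu hv n
    induction n with
    | zero =>
      intro a b hab
      refine le_add_left (ENNReal.coe_le_coe.2 ?_)
      have ha : a ≤ 1 := hab ▸ le_self_add
      have hb : b ≤ 1 := hab ▸ le_add_self
      rw [pow_zero, one_mul]
      exact add_le_add (mul_le_of_le_one_left' ha) (mul_le_of_le_one_left' hb)
    | succ n ih =>
      have half : ∀ (z : E) (w : ℝ≥0), z ∈ S → (w : ℝ≥0∞) ≤ g z → ∀ (a b : ℝ≥0),
          a + b = 1 →
          ((2⁻¹ * w + 2⁻¹ * (a * u + b * v) : ℝ≥0) : ℝ≥0∞) ≤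
          g ((2⁻¹ : ℝ≥0) • z + (2⁻¹ : ℝ≥0) • (a • x + b • y)) +
            (((2⁻¹ : ℝ≥0) ^ (n + 1) * (u + v) : ℝ≥0) : ℝ≥0∞) := by
        intro z w hz hw a b hab
        have h1 := ih a b hab
        calc ((2⁻¹ * w + 2⁻¹ * (a * u + b * v) : ℝ≥0) : ℝ≥0∞)
            = (2 : ℝ≥0∞)⁻¹ * (w + ((a * u + b * v : ℝ≥0) : ℝ≥0∞)) := by
              rw [inv_two_mul_coe_add, div_eq_inv_mul, mul_add 2⁻¹ w]
          _ ≤ (2 : ℝ≥0∞)⁻¹ * (g z + (g (a • x + b • y) +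
                (((2⁻¹ : ℝ≥0) ^ n * (u + v) : ℝ≥0) : ℝ≥0∞))) := by gcongr
          _ = (2 : ℝ≥0∞)⁻¹ * (g z + g (a • x + b • y)) +
                (((2⁻¹ : ℝ≥0) ^ (n + 1) * (u + v) : ℝ≥0) : ℝ≥0∞) := by
              rw [← add_assoc, mul_add]
              congr 1
              rw [pow_succ', mul_assoc, ENNReal.coe_mul 2⁻¹, ENNReal.coe_inv (by norm_num)]; simp
          _ ≤ _ := by gcongr; exact hg z hz _ (hS x hx y hy a b hab)
      intro a b hab
      rcases le_total a b with h | h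
      · have hb : (1 : ℝ≥0) ≤ 2 * b := by rw [← hab, two_mul]; gcongr
        obtain ⟨d, hd⟩ := exists_add_of_le hb
        have had : 2 * a + d = 1 := by
          have : (2 * a + d : ℝ) = 1 := by
            have e1 : (a + b : ℝ) = 1 := by exact_mod_cast hab
            have e2 : (2 * b : ℝ) = 1 + d := by exact_mod_cast hd
            linarith
          exact_mod_cast this
        have hb' : b = 2⁻¹ + 2⁻¹ * d := by
          rw [← mul_one_add, ← hd, ← mul_assoc, inv_mul_cancel₀ (by norm_num), one_mul]
        have ha' : a = 2⁻¹ * (2 * a) := by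
          rw [← mul_assoc, inv_mul_cancel₀ (by norm_num), one_mul]
        have := half y v hy hv (2 * a) d had
        have e1 : a * u + b * v = 2⁻¹ * v + 2⁻¹ * (2 * a * u + d * v) := by
          apply NNReal.eq
          rw [hb']
          push_cast
          ring
        have e2 : a • x + b • y = (2⁻¹ : ℝ≥0) • y + (2⁻¹ : ℝ≥0) • ((2 * a) • x + d • y) := by
          conv_lhs => rw [hb', ha']
          simp only [add_smul, smul_add, smul_smul]
          abel
        rw [e1, e2]
        exact this
      · have ha : (1 : ℝ≥0) ≤ 2 * a := by rw [← hab, two_mul]; gcongr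
        obtain ⟨d, hd⟩ := exists_add_of_le ha
        have had : d + 2 * b = 1 := by
          have : (d + 2 * b : ℝ) = 1 := by
            have e1 : (a + b : ℝ) = 1 := by exact_mod_cast hab
            have e2 : (2 * a : ℝ) = 1 + d := by exact_mod_cast hd
            linarith
          exact_mod_cast this
        have ha' : a = 2⁻¹ + 2⁻¹ * d := by
          rw [← mul_one_add, ← hd, ← mul_assoc, inv_mul_cancel₀ (by norm_num), one_mul]
        have hb' : b = 2⁻¹ * (2 * b) := by
          rw [← mul_assoc, inv_mul_cancel₀ (by norm_num), one_mul]
        have := half x u hx hu d (2 * b) had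
        have e1 : a * u + b * v = 2⁻¹ * u + 2⁻¹ * (d * u + 2 * b * v) := by
          apply NNReal.eq
          rw [ha']
          push_cast
          ring
        have e2 : a • x + b • y = (2⁻¹ : ℝ≥0) • x + (2⁻¹ : ℝ≥0) • (d • x + (2 * b) • y) := by
          conv_lhs => rw [ha', hb']
          simp only [add_smul, smul_add, smul_smul]
          abel
        rw [e1, e2]
        exact this
  have key2 : ∀ (u v : ℝ≥0), (u : ℝ≥0∞) ≤ g x → (v : ℝ≥0∞) ≤ g y →
      (a * u + b * v : ℝ≥0∞) ≤ g (a • x + b • y) := by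
    intro u v hu hv
    have lim : Filter.Tendsto (fun n : ℕ => g (a • x + b • y) +
        (((2⁻¹ : ℝ≥0) ^ n * (u + v) : ℝ≥0) : ℝ≥0∞)) Filter.atTop
        (nhds (g (a • x + b • y) + ((0 * (u + v) : ℝ≥0) : ℝ≥0∞))) := by
      refine tendsto_const_nhds.add (ENNReal.tendsto_coe.2 ?_)
      exact (tendsto_pow_atTop_nhds_zero_of_lt_one (by simp)
        (by exact_mod_cast (by norm_num : (2⁻¹ : ℝ) < 1))).mul_const _
    have := ge_of_tendsto' lim fun n => key u v hu hv n a b hab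
    simpa using this
  have trunc : ∀ c : ℝ≥0∞, Filter.Tendsto (fun n : ℕ => min c n) Filter.atTop (nhds c) := fun c => by
    simpa using (tendsto_const_nhds (x := c)).min ENNReal.tendsto_nat_nhds_top
  have trunc_coe : ∀ (c : ℝ≥0∞) (n : ℕ), ((min c n).toNNReal : ℝ≥0∞) = min c n := fun c n =>
    ENNReal.coe_toNNReal (ne_top_of_le_ne_top (ENNReal.natCast_ne_top n) (min_le_right _ _))
  refine le_of_tendsto' ((ENNReal.Tendsto.const_mul (trunc (g x)) (.inr ENNReal.coe_ne_top)).add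
    (ENNReal.Tendsto.const_mul (trunc (g y)) (.inr ENNReal.coe_ne_top))) fun n => ?_
  have := key2 (min (g x) n).toNNReal (min (g y) n).toNNReal
    (by rw [trunc_coe]; exact min_le_left _ _) (by rw [trunc_coe]; exact min_le_left _ _)
  rwa [trunc_coe, trunc_coe] at this

/-! ### Admissible pairs and the domain of the dyadic Bellman function -/

/-- The admissible pairs `(f, α)` in the definition of the dyadic Bellman function. -/
structure DyadicAdmissible (p : ℝ) (I : ℤ × ℤ) (F t M C : ℝ≥0) (f : ℝ → ℝ≥0)
    (α : ℤ × ℤ → ℝ≥0) : Prop where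
  measurable : Measurable f
  average_rpow : dyadicAverage (fun x => (f x : ℝ≥0∞) ^ p) I = F
  average : dyadicAverage (fun x => (f x : ℝ≥0∞)) I = t
  mass : (dyadicLength I : ℝ≥0∞)⁻¹ * sumBelow (fun J => (α J : ℝ≥0∞)) I = M
  carleson : DyadicCarleson C α

/-- The quantity that is maximized in the definition of the dyadic Bellman function. -/
noncomputable def dyadicValue (p : ℝ) (I : ℤ × ℤ) (f : ℝ → ℝ≥0) (α : ℤ × ℤ → ℝ≥0) : ℝ≥0∞ :=
  (dyadicLength I : ℝ≥0∞)⁻¹ *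
    sumBelow (fun J => (α J : ℝ≥0∞) * dyadicAverage (fun x => (f x : ℝ≥0∞)) J ^ p) I

lemma dyadicValue_le_dyadicBellman {p : ℝ} {I : ℤ × ℤ} {F t M C : ℝ≥0} {f : ℝ → ℝ≥0}
    {α : ℤ × ℤ → ℝ≥0} (h : DyadicAdmissible p I F t M C f α) :
    dyadicValue p I f α ≤ dyadicBellman p I F t M C := by
  refine le_sSup ⟨f, α, h.measurable, h.average_rpow, h.average, ?_, h.carleson, ?_⟩
  · rw [volume_dyadicInterval]; exact h.mass
  · rw [volume_dyadicInterval]; rfl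

lemma dyadicBellman_le {p : ℝ} {I : ℤ × ℤ} {F t M C : ℝ≥0} {b : ℝ≥0∞}
    (h : ∀ f α, DyadicAdmissible p I F t M C f α → dyadicValue p I f α ≤ b) :
    dyadicBellman p I F t M C ≤ b := by
  refine sSup_le ?_
  rintro v ⟨f, α, h1, h2, h3, h4, h5, rfl⟩
  rw [volume_dyadicInterval] at h4 ⊢
  exact h f α ⟨h1, h2, h3, h4, h5⟩

lemma dyadicBellman_eq_iSup (p : ℝ) (I : ℤ × ℤ) (F t M C : ℝ≥0) :
    dyadicBellman p I F t M C = ⨆ q : {q : (ℝ → ℝ≥0) × (ℤ × ℤ → ℝ≥0) //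
      DyadicAdmissible p I F t M C q.1 q.2}, dyadicValue p I q.1.1 q.1.2 :=
  le_antisymm (dyadicBellman_le fun f α h => le_iSup_of_le ⟨(f, α), h⟩ le_rfl)
    (iSup_le fun q => dyadicValue_le_dyadicBellman q.2)

/-- The set of points at which the supremum in the dyadic Bellman function is not over the
empty set. -/
def bellmanDomain (p : ℝ) (C : ℝ≥0) : Set (ℝ≥0 × ℝ≥0 × ℝ≥0) :=
  {x | x.2.1 ^ p ≤ x.1 ∧ (x.2.1 = 0 → x.1 = 0) ∧ x.2.2 ≤ C}

lemma bellmanDomain_convex {p : ℝ} (hp : 1 < p) {C : ℝ≥0} : ∀ x ∈ bellmanDomain p C,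
    ∀ y ∈ bellmanDomain p C, ∀ a b : ℝ≥0, a + b = 1 → a • x + b • y ∈ bellmanDomain p C := by
  rintro ⟨F, t, M⟩ ⟨h1, h2, h3⟩ ⟨F', t', M'⟩ ⟨h1', h2', h3'⟩ a b hab
  simp only at h1 h2 h3 h1' h2' h3'
  refine ⟨?_, ?_, ?_⟩
  · simp only [Prod.smul_mk, Prod.mk_add_mk, smul_eq_mul]
    refine (NNReal.rpow_arith_mean_le_arith_mean2_rpow a b t t' hab hp.le).trans ?_
    gcongr
  · simp only [Prod.smul_mk, Prod.mk_add_mk, smul_eq_mul, add_eq_zero, mul_eq_zero]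
    rintro ⟨h | h, h' | h'⟩ <;> simp [h, h', h2, h2']
  · simp only [Prod.smul_mk, Prod.mk_add_mk, smul_eq_mul]
    calc a * M + b * M' ≤ a * C + b * C := by gcongr
      _ = C := by rw [← add_mul, hab, one_mul]

/-- A function equal to `b` on a fraction `s` of an interval and zero elsewhere has averages `b * s`
and `b ^ p * s`. Eliminating `b` gives `s ^ (p - 1) = t ^ p / F`. -/
lemma exists_height_width {p : ℝ} (hp : 1 < p) {F t : ℝ≥0} (h1 : t ^ p ≤ F) (h2 : t = 0 → F = 0) :
    ∃ b s : ℝ≥0, s ≤ 1 ∧ b * s = t ∧ b ^ p * s = F := by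
  by_cases ht : t = 0
  · exact ⟨0, 0, by simp, by simp [ht], by simp [h2 ht]⟩
  have hp0 : p - 1 ≠ 0 := by linarith
  have hF : F ≠ 0 := by
    rintro rfl
    exact (NNReal.rpow_pos (pos_iff_ne_zero.2 ht)).ne' (le_antisymm h1 zero_le)
  set s : ℝ≥0 := (t ^ p / F) ^ (p - 1)⁻¹ with hs
  have hs0 : s ≠ 0 :=
    (NNReal.rpow_pos (div_pos (NNReal.rpow_pos (pos_iff_ne_zero.2 ht)) (pos_iff_ne_zero.2 hF))).ne'
  have hsp : s ^ (p - 1) = t ^ p / F := by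
    rw [hs, ← NNReal.rpow_mul, inv_mul_cancel₀ hp0, NNReal.rpow_one]
  refine ⟨t / s, s, ?_, div_mul_cancel₀ _ hs0, ?_⟩
  · refine NNReal.rpow_le_one (div_le_one_of_le₀ h1 zero_le) (inv_nonneg.2 (by linarith))
  · rw [NNReal.div_rpow]
    have e : s ^ p = s ^ (p - 1) * s := by
      rw [← NNReal.rpow_add_one hs0]; congr 1; ring
    have htp : t ^ p ≠ 0 := (NNReal.rpow_pos (pos_iff_ne_zero.2 ht)).ne'
    rw [e, hsp]
    field_simp

/-- A dyadic interval not contained in `I` either contains `I`, and then has the same sum and a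
greater length, or is disjoint from it, and then has sum zero. -/
lemma dyadicCarleson_of_support {C : ℝ≥0} {α : ℤ × ℤ → ℝ≥0} {I : ℤ × ℤ}
    (hα : ∀ J, ¬ dyadicInterval J ⊆ dyadicInterval I → α J = 0)
    (h : ∀ J, dyadicInterval J ⊆ dyadicInterval I →
      sumBelow (fun J' => (α J' : ℝ≥0∞)) J ≤ C * dyadicLength J) :
    DyadicCarleson C α := by
  classical
  intro J
  rw [volume_dyadicInterval]
  by_cases hJ : dyadicInterval J ⊆ dyadicInterval I
  · exact h J hJ
  by_cases hI : dyadicInterval I ⊆ dyadicInterval J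
  · calc sumBelow (fun J' => (α J' : ℝ≥0∞)) J ≤ sumBelow (fun J' => (α J' : ℝ≥0∞)) I := by
          rw [sumBelow_eq_tsum, sumBelow_eq_tsum]
          refine ENNReal.tsum_le_tsum fun K => ?_
          by_cases hK : dyadicInterval K ⊆ dyadicInterval I
          · simp only [hK, if_true]; split_ifs <;> simp
          · simp [hα K hK]
      _ ≤ C * dyadicLength I := h I subset_rfl
      _ ≤ C * dyadicLength J := by
          have := measure_mono (μ := volume) hI
          rw [volume_dyadicInterval, volume_dyadicInterval] at this
          gcongr
  · have : sumBelow (fun J' => (α J' : ℝ≥0∞)) J = 0 := by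
      rw [sumBelow, ENNReal.tsum_eq_zero]
      rintro ⟨K, hK⟩
      simp only [ENNReal.coe_eq_zero]
      refine hα K fun hKI => ?_
      have hx := left_mem_dyadicInterval K
      rcases le_total J.1 I.1 with hle | hle
      · exact hJ (dyadicInterval_subset_of_mem hle (hK hx) (hKI hx))
      · exact hI (dyadicInterval_subset_of_mem hle (hKI hx) (hK hx))
    rw [this]; exact zero_le

/-- The whole mass sits on `I`, and `f` takes one nonzero value. This keeps the suprema over the two
halves from being empty, without which an estimate from below by gluing would fail. -/
lemma exists_dyadicAdmissible {p : ℝ} (hp : 1 < p) {C F t M : ℝ≥0}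
    (h : (F, t, M) ∈ bellmanDomain p C) (I : ℤ × ℤ) :
    ∃ f α, DyadicAdmissible p I F t M C f α := by
  classical
  obtain ⟨h1, h2, h3⟩ := h
  obtain ⟨b, s, hs, rfl, rfl⟩ := exists_height_width hp h1 h2
  have hIpos : (0 : ℝ) < 2 ^ I.1 := by positivity
  set A : Set ℝ := Set.Ico ((I.2 : ℝ) * 2 ^ I.1) ((I.2 : ℝ) * 2 ^ I.1 + s * dyadicLength I) with hA
  have hAm : MeasurableSet A := measurableSet_Ico
  have hAvol : volume A = s * dyadicLength I := by
    rw [hA, Real.volume_Ico, add_sub_cancel_left, ← NNReal.coe_mul, ENNReal.ofReal_coe_nnreal,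
      ENNReal.coe_mul]
  have hAI : A ⊆ dyadicInterval I := by
    refine Set.Ico_subset_Ico_right ?_
    rw [add_mul, one_mul]
    have : (dyadicLength I : ℝ) = 2 ^ I.1 := by simp [dyadicLength]
    rw [this]
    have hs' : (s : ℝ) ≤ 1 := by exact_mod_cast hs
    nlinarith
  have avg : ∀ c : ℝ≥0, dyadicAverage (A.indicator fun _ => (c : ℝ≥0∞)) I = (c * s : ℝ≥0) := by
    intro c
    rw [dyadicAverage_eq, lintegral_indicator hAm, setLIntegral_const,
      Measure.restrict_apply hAm, Set.inter_eq_left.2 hAI, hAvol, mul_comm, mul_assoc, mul_assoc,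
      ENNReal.mul_inv_cancel (coe_dyadicLength_ne_zero I) ENNReal.coe_ne_top, mul_one,
      ENNReal.coe_mul]
  have hsum : ∀ J, sumBelow (fun J' => ((if J' = I then M * dyadicLength I else 0 : ℝ≥0) : ℝ≥0∞)) J =
      if dyadicInterval I ⊆ dyadicInterval J then (M * dyadicLength I : ℝ≥0∞) else 0 := by
    intro J
    rw [sumBelow_eq_tsum, tsum_eq_single I]
    · simp
    · intro K hK; simp [hK]
  refine ⟨A.indicator fun _ => b, fun J => if J = I then M * dyadicLength I else 0,
    measurable_const.indicator hAm, ?_, ?_, ?_, ?_⟩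
  · rw [← avg]
    refine dyadicAverage_congr fun x _ => ?_
    by_cases hx : x ∈ A
    · simp only [hx, Set.indicator_of_mem]
      rw [ENNReal.coe_rpow_of_nonneg _ (by linarith)]
    · simp [hx, show 0 < p by linarith]
  · rw [← avg]
    refine dyadicAverage_congr fun x _ => ?_
    by_cases hx : x ∈ A <;> simp [hx]
  · rw [hsum, if_pos subset_rfl, mul_comm, mul_assoc,
      ENNReal.mul_inv_cancel (coe_dyadicLength_ne_zero I) ENNReal.coe_ne_top, mul_one]
  · refine dyadicCarleson_of_support (I := I) (fun J hJ => ?_) fun J hJ => ?_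
    · rw [if_neg]; rintro rfl; exact hJ subset_rfl
    · rw [hsum]
      split_ifs with h
      · rw [dyadicInterval_injective (h.antisymm hJ)]
        gcongr
      · exact zero_le

/-! ### Gluing, and the main inequality for the dyadic Bellman function -/

/-- Admissible pairs on the two halves of a dyadic interval can be glued. -/
lemma exists_glued_dyadicAdmissible {p : ℝ} {I : ℤ × ℤ} {C a F₁ t₁ M₁ F₂ t₂ M₂ : ℝ≥0}
    {f₁ f₂ : ℝ → ℝ≥0} {α₁ α₂ : ℤ × ℤ → ℝ≥0}
    (h₁ : DyadicAdmissible p (leftChild I) F₁ t₁ M₁ C f₁ α₁)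
    (h₂ : DyadicAdmissible p (rightChild I) F₂ t₂ M₂ C f₂ α₂)
    (hC : a + (M₁ + M₂) / 2 ≤ C) :
    ∃ f α, DyadicAdmissible p I ((F₁ + F₂) / 2) ((t₁ + t₂) / 2) (a + (M₁ + M₂) / 2) C f α ∧
      dyadicValue p I f α = a * (((t₁ + t₂) / 2 : ℝ≥0) : ℝ≥0∞) ^ p + 2⁻¹ *
        (dyadicValue p (leftChild I) f₁ α₁ + dyadicValue p (rightChild I) f₂ α₂) := by
  classical
  set f : ℝ → ℝ≥0 := fun x => if x ∈ dyadicInterval (leftChild I) then f₁ x else f₂ x with hf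
  set α : ℤ × ℤ → ℝ≥0 := fun J => if J = I then a * dyadicLength I else
    if dyadicInterval J ⊆ dyadicInterval (leftChild I) then α₁ J else
      if dyadicInterval J ⊆ dyadicInterval (rightChild I) then α₂ J else 0 with hα
  have hfl : ∀ x ∈ dyadicInterval (leftChild I), f x = f₁ x := fun x hx => by simp [hf, hx]
  have hfr : ∀ x ∈ dyadicInterval (rightChild I), f x = f₂ x := fun x hx => by
    have : x ∉ dyadicInterval (leftChild I) := Set.disjoint_right.1 (disjoint_children I) hx
    simp [hf, this]
  have hαI : α I = a * dyadicLength I := by simp [hα]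
  have hαl : ∀ J, dyadicInterval J ⊆ dyadicInterval (leftChild I) → α J = α₁ J := by
    intro J hJ
    have : J ≠ I := by rintro rfl; exact not_subset_leftChild _ hJ
    simp [hα, hJ, this]
  have hαr : ∀ J, dyadicInterval J ⊆ dyadicInterval (rightChild I) → α J = α₂ J := by
    intro J hJ
    have : J ≠ I := by rintro rfl; exact not_subset_rightChild _ hJ
    have h' : ¬ dyadicInterval J ⊆ dyadicInterval (leftChild I) := fun h => not_subset_both h hJ
    simp [hα, hJ, this, h']
  have avg : ∀ (G : ℝ≥0 → ℝ≥0∞), dyadicAverage (fun x => G (f x)) I = 2⁻¹ *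
      (dyadicAverage (fun x => G (f₁ x)) (leftChild I) +
        dyadicAverage (fun x => G (f₂ x)) (rightChild I)) := by
    intro G
    rw [dyadicAverage_eq_children]
    congr 2
    · exact dyadicAverage_congr fun x hx => by rw [hfl x hx]
    · exact dyadicAverage_congr fun x hx => by rw [hfr x hx]
  have hmass : (dyadicLength I : ℝ≥0∞)⁻¹ * sumBelow (fun J => (α J : ℝ≥0∞)) I =
      (a + (M₁ + M₂) / 2 : ℝ≥0) := by
    rw [normalized_sumBelow_eq_children, hαI,
      sumBelow_congr (I := leftChild I) (b := fun J => (α₁ J : ℝ≥0∞)) fun J hJ => by rw [hαl J hJ],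
      sumBelow_congr (I := rightChild I) (b := fun J => (α₂ J : ℝ≥0∞)) fun J hJ => by rw [hαr J hJ],
      h₁.mass, h₂.mass, inv_two_mul_coe_add, ENNReal.coe_mul, mul_left_comm,
      ENNReal.inv_mul_cancel (coe_dyadicLength_ne_zero I) ENNReal.coe_ne_top, mul_one,
      ← ENNReal.coe_add]
  have havg : dyadicAverage (fun x => (f x : ℝ≥0∞)) I = ((t₁ + t₂) / 2 : ℝ≥0) := by
    rw [avg (fun y => (y : ℝ≥0∞)), h₁.average, h₂.average, inv_two_mul_coe_add]
  refine ⟨f, α, ⟨?_, ?_, havg, hmass, ?_⟩, ?_⟩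
  · exact Measurable.ite (measurableSet_dyadicInterval _) h₁.measurable h₂.measurable
  · rw [avg (fun y => (y : ℝ≥0∞) ^ p), h₁.average_rpow, h₂.average_rpow, inv_two_mul_coe_add]
  · refine dyadicCarleson_of_support (I := I) (fun J hJ => ?_) fun J hJ => ?_
    · rw [subset_iff_eq_or_subset_child] at hJ
      push Not at hJ
      simp [hα, hJ.1, hJ.2.1, hJ.2.2]
    · rcases subset_iff_eq_or_subset_child.1 hJ with rfl | hJ | hJ
      -- Only the top interval needs the hypothesis `hC`; the smaller ones inherit the condition
      -- from the two halves.
      · have h := (ENNReal.eq_div_iff (coe_dyadicLength_ne_zero J) ENNReal.coe_ne_top).1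
          ((ENNReal.div_eq_inv_mul.trans hmass).symm)
        rw [← h, mul_comm]
        gcongr
      · rw [sumBelow_congr (b := fun J => (α₁ J : ℝ≥0∞)) fun K hK => by rw [hαl K (hK.trans hJ)],
          ← volume_dyadicInterval]
        exact h₁.carleson J
      · rw [sumBelow_congr (b := fun J => (α₂ J : ℝ≥0∞)) fun K hK => by rw [hαr K (hK.trans hJ)],
          ← volume_dyadicInterval]
        exact h₂.carleson J
  · rw [dyadicValue, normalized_sumBelow_eq_children, hαI, havg, ENNReal.coe_mul]
    congr 1
    · rw [mul_comm (a : ℝ≥0∞), mul_assoc, ← mul_assoc,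
        ENNReal.inv_mul_cancel (coe_dyadicLength_ne_zero I) ENNReal.coe_ne_top, one_mul]
    · congr 2
      · rw [dyadicValue]
        congr 1
        refine sumBelow_congr fun J hJ => ?_
        rw [hαl J hJ, dyadicAverage_congr fun x hx => by rw [hfl x (hJ hx)]]
      · rw [dyadicValue]
        congr 1
        refine sumBelow_congr fun J hJ => ?_
        rw [hαr J hJ, dyadicAverage_congr fun x hx => by rw [hfr x (hJ hx)]]

/-- The infimum over all dyadic intervals of the dyadic Bellman functions. -/
noncomputable def infBellman (p : ℝ) (C : ℝ≥0) (x : ℝ≥0 × ℝ≥0 × ℝ≥0) : ℝ≥0∞ :=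
  ⨅ I, dyadicBellman p I x.1 x.2.1 x.2.2 C

/-- Gluing bounds the Bellman function on `I` below by those on its two halves. Passing to the
infimum over all intervals on both sides removes the dependence on the interval, so invariance under
dilations and translations is not needed. -/
lemma infBellman_midpoint {p : ℝ} (hp : 1 < p) {C a : ℝ≥0} {x y : ℝ≥0 × ℝ≥0 × ℝ≥0}
    (hx : x ∈ bellmanDomain p C) (hy : y ∈ bellmanDomain p C) (hC : a + (x.2.2 + y.2.2) / 2 ≤ C) :
    a * (((x.2.1 + y.2.1) / 2 : ℝ≥0) : ℝ≥0∞) ^ p + 2⁻¹ * (infBellman p C x + infBellman p C y) ≤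
      infBellman p C ((x.1 + y.1) / 2, (x.2.1 + y.2.1) / 2, a + (x.2.2 + y.2.2) / 2) := by
  refine le_iInf fun I => ?_
  obtain ⟨f₁, α₁, h₁⟩ := exists_dyadicAdmissible hp hx (leftChild I)
  obtain ⟨f₂, α₂, h₂⟩ := exists_dyadicAdmissible hp hy (rightChild I)
  have n₁ : Nonempty {q : (ℝ → ℝ≥0) × (ℤ × ℤ → ℝ≥0) //
    DyadicAdmissible p (leftChild I) x.1 x.2.1 x.2.2 C q.1 q.2} := ⟨⟨(f₁, α₁), h₁⟩⟩
  have n₂ : Nonempty {q : (ℝ → ℝ≥0) × (ℤ × ℤ → ℝ≥0) //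
    DyadicAdmissible p (rightChild I) y.1 y.2.1 y.2.2 C q.1 q.2} := ⟨⟨(f₂, α₂), h₂⟩⟩
  calc _ ≤ a * (((x.2.1 + y.2.1) / 2 : ℝ≥0) : ℝ≥0∞) ^ p + 2⁻¹ *
        (dyadicBellman p (leftChild I) x.1 x.2.1 x.2.2 C +
          dyadicBellman p (rightChild I) y.1 y.2.1 y.2.2 C) := by
        gcongr
        · exact iInf_le _ _
        · exact iInf_le _ _
    _ ≤ _ := by
      rw [dyadicBellman_eq_iSup, dyadicBellman_eq_iSup p (rightChild I), mul_add,
        ENNReal.mul_iSup, ENNReal.mul_iSup, ← add_assoc, ENNReal.add_iSup]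
      refine iSup_le fun r => ?_
      rw [ENNReal.add_iSup, ENNReal.iSup_add]
      refine iSup_le fun q => ?_
      obtain ⟨f, α, h, hv⟩ := exists_glued_dyadicAdmissible q.2 r.2 hC
      rw [add_assoc, ← mul_add, ← hv]
      exact dyadicValue_le_dyadicBellman h

/-- Gluing two pairs at the same point changes nothing but the weight `a` on the parent. -/
lemma infBellman_jump {p : ℝ} (hp : 1 < p) {C a F t M : ℝ≥0}
    (hx : (F, t, M) ∈ bellmanDomain p C) (hC : a + M ≤ C) :
    a * (t : ℝ≥0∞) ^ p + infBellman p C (F, t, M) ≤ infBellman p C (F, t, a + M) := by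
  have e : ∀ z : ℝ≥0, (z + z) / 2 = z := fun z => by rw [← two_mul]; simp
  have := infBellman_midpoint hp hx hx (a := a) (by simpa only [e] using hC)
  simp only [e] at this
  rwa [← two_mul, ← mul_assoc, ENNReal.inv_mul_cancel (by simp) (by simp), one_mul] at this

lemma infBellman_concave {p : ℝ} (hp : 1 < p) {C : ℝ≥0} {x y : ℝ≥0 × ℝ≥0 × ℝ≥0}
    (hx : x ∈ bellmanDomain p C) (hy : y ∈ bellmanDomain p C) {a b : ℝ≥0} (hab : a + b = 1) :
    a * infBellman p C x + b * infBellman p C y ≤ infBellman p C (a • x + b • y) := by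
  refine concave_of_midpoint_concave (bellmanDomain_convex hp) ?_ hx hy hab
  intro x hx y hy
  have hM : (x.2.2 + y.2.2) / 2 ≤ C := by
    have := (bellmanDomain_convex hp x hx y hy 2⁻¹ 2⁻¹ (by rw [← two_mul]; simp)).2.2
    rw [div_eq_inv_mul, mul_add]
    exact this
  have := infBellman_midpoint hp hx hy (a := 0) (by simpa using hM)
  simp only [ENNReal.coe_zero, zero_mul, zero_add] at this
  convert this using 2
  obtain ⟨F, t, M⟩ := x
  obtain ⟨F', t', M'⟩ := y
  simp [div_eq_inv_mul, mul_add]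

/-! ### The perspective of the Bellman function -/

/-- The perspective function of `infBellman`. -/
noncomputable def bellmanPerspective (p : ℝ) (C m : ℝ≥0) (x : ℝ≥0 × ℝ≥0 × ℝ≥0) : ℝ≥0∞ :=
  m * infBellman p C (m⁻¹ • x)

/-- The cone over the domain of the Bellman function. -/
def bellmanCone (p : ℝ) (C m : ℝ≥0) : Set (ℝ≥0 × ℝ≥0 × ℝ≥0) :=
  {x | (m = 0 ∧ x = 0) ∨ (m ≠ 0 ∧ m⁻¹ • x ∈ bellmanDomain p C)}

/-- Concavity with the weights `m / (m + n)` and `n / (m + n)`, multiplied by `m + n`. The apex of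
the cone, where the mass vanishes, is treated apart. -/
lemma bellmanPerspective_add {p : ℝ} (hp : 1 < p) {C m n : ℝ≥0} {x y : ℝ≥0 × ℝ≥0 × ℝ≥0}
    (hx : x ∈ bellmanCone p C m) (hy : y ∈ bellmanCone p C n) :
    bellmanPerspective p C m x + bellmanPerspective p C n y ≤
      bellmanPerspective p C (m + n) (x + y) := by
  rcases hx with ⟨rfl, rfl⟩ | ⟨hm, hx⟩
  · simp [bellmanPerspective]
  rcases hy with ⟨rfl, rfl⟩ | ⟨hn, hy⟩
  · simp [bellmanPerspective]
  have hmn : m + n ≠ 0 := by simp [hm]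
  have hab : m / (m + n) + n / (m + n) = 1 := by rw [← add_div, div_self hmn]
  have := infBellman_concave hp hx hy hab
  have e : (m / (m + n)) • m⁻¹ • x + (n / (m + n)) • n⁻¹ • y = (m + n)⁻¹ • (x + y) := by
    rw [smul_smul, smul_smul, smul_add]
    congr 2 <;> field_simp
  rw [e] at this
  calc bellmanPerspective p C m x + bellmanPerspective p C n y
      = ((m + n : ℝ≥0) : ℝ≥0∞) * ((m / (m + n) : ℝ≥0) * infBellman p C (m⁻¹ • x) +
        (n / (m + n) : ℝ≥0) * infBellman p C (n⁻¹ • y)) := by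
        rw [mul_add, ← mul_assoc, ← mul_assoc, ← ENNReal.coe_mul, ← ENNReal.coe_mul,
          mul_div_cancel₀ _ hmn, mul_div_cancel₀ _ hmn]
        rfl
    _ ≤ _ := by
        rw [bellmanPerspective]; gcongr

lemma bellmanPerspective_jump {p : ℝ} (hp : 1 < p) {C m a F t M : ℝ≥0}
    (hx : (F, t, M) ∈ bellmanCone p C m) (hC : a + M ≤ C * m) :
    a * ((t / m : ℝ≥0) : ℝ≥0∞) ^ p + bellmanPerspective p C m (F, t, M) ≤
      bellmanPerspective p C m (F, t, a + M) := by
  rcases hx with ⟨rfl, hx⟩ | ⟨hm, hx⟩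
  · have : a = 0 := by simp at hC; exact hC.1
    simp [bellmanPerspective, this]
  have := infBellman_jump hp hx (a := m⁻¹ * a)
    (by simp only [smul_eq_mul]; rw [← mul_add, inv_mul_le_iff₀ (pos_iff_ne_zero.2 hm), mul_comm]; exact hC)
  simp only [smul_eq_mul, ← mul_add] at this
  have h2 := mul_le_mul_right this (m : ℝ≥0∞)
  rw [mul_add, ← mul_assoc, ← ENNReal.coe_mul, mul_inv_cancel_left₀ hm] at h2
  rw [div_eq_inv_mul]
  exact h2

/-! ### The tangent line inequality and Jensen's inequality -/

/-- The tangent line inequality for `y ↦ y ^ p`. -/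
lemma tangent_le_rpow {p : ℝ} (hp : 1 < p) (t : ℝ≥0) (y : ℝ≥0∞) :
    p.toNNReal * (t : ℝ≥0∞) ^ (p - 1) * y ≤ y ^ p + (p - 1).toNNReal * (t : ℝ≥0∞) ^ p := by
  have hp0 : 0 < p := by linarith
  induction y with
  | top => simp [ENNReal.top_rpow_of_pos hp0]
  | coe y =>
    rw [← ENNReal.coe_rpow_of_nonneg _ hp0.le, ← ENNReal.coe_rpow_of_nonneg _ hp0.le,
      ← ENNReal.coe_rpow_of_nonneg _ (by linarith : 0 ≤ p - 1)]
    norm_cast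
    have hpq : p.HolderConjugate (p / (p - 1)) := Real.HolderConjugate.conjExponent hp
    have h := Real.young_inequality_of_nonneg (NNReal.coe_nonneg y) (NNReal.coe_nonneg (t ^ (p - 1))) hpq
    rw [← NNReal.coe_le_coe]
    push_cast at h ⊢
    rw [Real.coe_toNNReal _ hp0.le, Real.coe_toNNReal _ (by linarith : 0 ≤ p - 1)]
    have hp1 : p - 1 ≠ 0 := by linarith
    rw [← Real.rpow_mul (NNReal.coe_nonneg t), mul_div_cancel₀ _ hp1] at h
    have h2 := mul_le_mul_of_nonneg_left h hp0.le
    calc p * (t : ℝ) ^ (p - 1) * y = p * (y * (t : ℝ) ^ (p - 1)) := by ring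
      _ ≤ _ := h2
      _ = _ := by field_simp

section
variable {X : Type*} {m : MeasurableSpace X}

/-- Jensen's inequality for the power function. -/
lemma rpow_mul_measure_le {p : ℝ} (hp : 1 < p) (ν : Measure X) [IsFiniteMeasure ν]
    {f : X → ℝ≥0∞} (hf : Measurable f) {t : ℝ≥0} (ht : ∫⁻ x, f x ∂ν = t * ν Set.univ) :
    (t : ℝ≥0∞) ^ p * ν Set.univ ≤ ∫⁻ x, f x ^ p ∂ν := by
  have hp0 : 0 < p := by linarith
  have h := lintegral_mono (μ := ν) fun x => tangent_le_rpow hp t (f x)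
  rw [lintegral_const_mul _ hf, lintegral_add_right _ measurable_const, lintegral_const, ht] at h
  have e1 : (t : ℝ≥0∞) ^ (p - 1) * t = (t : ℝ≥0∞) ^ p := by
    rw [← ENNReal.coe_rpow_of_nonneg _ hp0.le,
      ← ENNReal.coe_rpow_of_nonneg _ (by linarith : 0 ≤ p - 1), ← ENNReal.coe_mul]
    congr 1
    rcases eq_or_ne t 0 with rfl | h0
    · simp [hp0.ne']
    · rw [← NNReal.rpow_add_one h0]; simp
  -- Writing `p` as `(p - 1) + 1` lets the finite constant term of the tangent line be cancelled
  -- without subtraction.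
  have e2 : (p.toNNReal : ℝ≥0∞) = (p - 1).toNNReal + 1 := by
    norm_cast
    rw [← Real.toNNReal_one, ← Real.toNNReal_add (by linarith) (by norm_num)]; simp
  have e3 : p.toNNReal * (t : ℝ≥0∞) ^ (p - 1) * (t * ν Set.univ) =
      (t : ℝ≥0∞) ^ p * ν Set.univ + (p - 1).toNNReal * (t : ℝ≥0∞) ^ p * ν Set.univ := by
    rw [← e1, e2]; ring
  rw [e3] at h
  refine (ENNReal.add_le_add_iff_right ?_).1 h
  finiteness

/-! ### The Bellman functional along a filtration: the upper bound -/

variable {μ : Measure X} {ℱ : Filtration ℕ m} {p : ℝ} {C : ℝ≥0}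
  {f : X → ℝ≥0} {α : ℕ → X → ℝ≥0}

/-- The tail sums of a sequence of non-negative random variables. -/
noncomputable def tailSum (α : ℕ → X → ℝ≥0) (n : ℕ) (x : X) : ℝ≥0∞ :=
  ∑' k : ℕ, (α (n + k) x : ℝ≥0∞)

lemma tailSum_eq_add (α : ℕ → X → ℝ≥0) (n : ℕ) (x : X) :
    tailSum α n x = α n x + tailSum α (n + 1) x := by
  rw [tailSum, tsum_eq_zero_add' ENNReal.summable]
  simp [tailSum, add_comm, add_left_comm]

lemma measurable_tailSum (hα : ∀ n, Measurable (α n)) (n : ℕ) : Measurable (tailSum α n) := by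
  unfold tailSum
  exact Measurable.tsum fun k => (hα _).coe_nnreal_ennreal

lemma IsCarlesonSequence.measurable (h : IsCarlesonSequence μ ℱ C α) (n : ℕ) :
    Measurable (α n) :=
  (h.1 n).mono (ℱ.le n) le_rfl

lemma IsCarlesonSequence.setLIntegral_tailSum_le [IsProbabilityMeasure μ] (h : IsCarlesonSequence μ ℱ C α) {n : ℕ}
    {A : Set X} (hA : MeasurableSet[ℱ n] A) : ∫⁻ x in A, tailSum α n x ∂μ ≤ C * μ A := by
  unfold tailSum
  rw [← setLIntegral_condLExp (ℱ.le n) μ _ hA, ← setLIntegral_const]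
  exact lintegral_mono_ae (ae_restrict_of_ae (h.2 n))

/-- The mass of a set, and the integrals over it that determine a point of the cone over the domain
of the Bellman function. -/
noncomputable def bellmanState (μ : Measure X) (p : ℝ) (f : X → ℝ≥0) (α : ℕ → X → ℝ≥0) (n : ℕ)
    (A : Set X) : ℝ≥0 × ℝ≥0 × ℝ≥0 :=
  ((∫⁻ x in A, (f x : ℝ≥0∞) ^ p ∂μ).toNNReal, (∫⁻ x in A, (f x : ℝ≥0∞) ∂μ).toNNReal,
    (∫⁻ x in A, tailSum α n x ∂μ).toNNReal)

lemma setLIntegral_ne_top {g : X → ℝ≥0∞} (h : ∫⁻ x, g x ∂μ ≠ ∞) (A : Set X) :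
    ∫⁻ x in A, g x ∂μ ≠ ∞ :=
  ne_top_of_le_ne_top h (setLIntegral_le_lintegral _ _)

/-- The three conditions of the domain are Jensen's inequality on `A`, the fact that a function of
zero integral vanishes almost everywhere, and the Carleson condition integrated over `A`. The last
is why `A` has to belong to `ℱ n`. -/
lemma bellmanState_mem_cone [IsProbabilityMeasure μ] (hp : 1 < p) (hf : Measurable f)
    (hF : ∫⁻ x, (f x : ℝ≥0∞) ^ p ∂μ ≠ ∞) (ht : ∫⁻ x, (f x : ℝ≥0∞) ∂μ ≠ ∞)
    (hα : IsCarlesonSequence μ ℱ C α) {n : ℕ} {A : Set X} (hA : MeasurableSet[ℱ n] A) :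
    bellmanState μ p f α n A ∈ bellmanCone p C (μ A).toNNReal := by
  have hp0 : 0 < p := by linarith
  by_cases h0 : μ A = 0
  · left
    simp [bellmanState, h0, Measure.restrict_eq_zero.2 h0]
  right
  have hm : (μ A).toNNReal ≠ 0 := by
    simp [ENNReal.toNNReal_eq_zero_iff, h0]
  have hμA : ((μ A).toNNReal : ℝ≥0∞) = μ A := ENNReal.coe_toNNReal (by finiteness)
  refine ⟨hm, ?_, ?_, ?_⟩
  · simp only [bellmanState, Prod.smul_mk, smul_eq_mul]
    set t := (μ A).toNNReal⁻¹ * (∫⁻ x in A, (f x : ℝ≥0∞) ∂μ).toNNReal with htdef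
    have h1 : ∫⁻ x in A, (f x : ℝ≥0∞) ∂μ = t * (μ.restrict A) Set.univ := by
      rw [Measure.restrict_apply_univ, ← hμA, ← ENNReal.coe_mul, htdef, mul_comm, ← mul_assoc,
        mul_inv_cancel₀ hm, one_mul, ENNReal.coe_toNNReal (setLIntegral_ne_top ht A)]
    have h2 := rpow_mul_measure_le hp (μ.restrict A) hf.coe_nnreal_ennreal h1
    rw [Measure.restrict_apply_univ, ← hμA, ← ENNReal.coe_toNNReal (setLIntegral_ne_top hF A),
      ← ENNReal.coe_rpow_of_nonneg _ hp0.le, ← ENNReal.coe_mul, ENNReal.coe_le_coe] at h2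
    rw [← div_eq_inv_mul, le_div_iff₀ (pos_iff_ne_zero.2 hm)]
    exact h2
  · simp only [bellmanState, Prod.smul_mk, smul_eq_mul, mul_eq_zero, inv_eq_zero, hm, false_or]
    intro h
    rw [ENNReal.toNNReal_eq_zero_iff, or_iff_left (setLIntegral_ne_top ht A),
      lintegral_eq_zero_iff hf.coe_nnreal_ennreal] at h
    rw [ENNReal.toNNReal_eq_zero_iff]
    left
    rw [lintegral_congr_ae (g := fun _ => 0) ?_, lintegral_zero]
    filter_upwards [h] with x hx
    simp only [Pi.zero_apply] at hx
    simp [hx, hp0]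
  · simp only [bellmanState, Prod.smul_mk, smul_eq_mul]
    rw [inv_mul_le_iff₀ (pos_iff_ne_zero.2 hm)]
    have h := hα.setLIntegral_tailSum_le hA
    rw [← hμA, ← ENNReal.coe_mul] at h
    exact (ENNReal.toNNReal_mono ENNReal.coe_ne_top h).trans (by simp [mul_comm])

lemma bellmanState_union {n : ℕ} {A B : Set X}
    (hF : ∫⁻ x, (f x : ℝ≥0∞) ^ p ∂μ ≠ ∞) (ht : ∫⁻ x, (f x : ℝ≥0∞) ∂μ ≠ ∞)
    (hM : ∫⁻ x, tailSum α n x ∂μ ≠ ∞) (hB : MeasurableSet B) (hAB : Disjoint A B) :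
    bellmanState μ p f α n (A ∪ B) = bellmanState μ p f α n A + bellmanState μ p f α n B := by
  simp only [bellmanState, Prod.mk_add_mk, lintegral_union hB hAB]
  rw [ENNReal.toNNReal_add, ENNReal.toNNReal_add, ENNReal.toNNReal_add] <;>
  exact setLIntegral_ne_top (by assumption) _

/-- The Bellman functional of the portion of the data that lies in the set `A`. -/
noncomputable def bellmanFunctional (μ : Measure X) (p : ℝ) (C : ℝ≥0) (f : X → ℝ≥0)
    (α : ℕ → X → ℝ≥0) (n : ℕ) (A : Set X) : ℝ≥0∞ :=
  bellmanPerspective p C (μ A).toNNReal (bellmanState μ p f α n A)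

lemma IsCarlesonSequence.lintegral_tailSum_ne_top [IsProbabilityMeasure μ] (hα : IsCarlesonSequence μ ℱ C α) (n : ℕ) :
    ∫⁻ x, tailSum α n x ∂μ ≠ ∞ := by
  have := hα.setLIntegral_tailSum_le (n := n) (A := Set.univ) MeasurableSet.univ
  rw [setLIntegral_univ] at this
  exact ne_top_of_le_ne_top (by finiteness) this

lemma bellmanFunctional_add_le [IsProbabilityMeasure μ] (hp : 1 < p) (hf : Measurable f)
    (hF : ∫⁻ x, (f x : ℝ≥0∞) ^ p ∂μ ≠ ∞) (ht : ∫⁻ x, (f x : ℝ≥0∞) ∂μ ≠ ∞)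
    (hα : IsCarlesonSequence μ ℱ C α) {n : ℕ} {A B : Set X} (hA : MeasurableSet[ℱ n] A)
    (hB : MeasurableSet[ℱ n] B) (hAB : Disjoint A B) :
    bellmanFunctional μ p C f α n A + bellmanFunctional μ p C f α n B ≤
      bellmanFunctional μ p C f α n (A ∪ B) := by
  have hB' := ℱ.le n _ hB
  rw [bellmanFunctional, bellmanFunctional, bellmanFunctional,
    bellmanState_union hF ht (hα.lintegral_tailSum_ne_top n) hB' hAB, measure_union hAB hB',
    ENNReal.toNNReal_add (by finiteness) (by finiteness)]
  exact bellmanPerspective_add hp (bellmanState_mem_cone hp hf hF ht hα hA)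
    (bellmanState_mem_cone hp hf hF ht hα hB)

lemma bellmanFunctional_mono [IsProbabilityMeasure μ] (hp : 1 < p) (hf : Measurable f)
    (hF : ∫⁻ x, (f x : ℝ≥0∞) ^ p ∂μ ≠ ∞) (ht : ∫⁻ x, (f x : ℝ≥0∞) ∂μ ≠ ∞)
    (hα : IsCarlesonSequence μ ℱ C α) {n : ℕ} {A B : Set X} (hA : MeasurableSet[ℱ n] A)
    (hB : MeasurableSet[ℱ n] B) (hAB : A ⊆ B) :
    bellmanFunctional μ p C f α n A ≤ bellmanFunctional μ p C f α n B := by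
  have := bellmanFunctional_add_le hp hf hF ht hα hA (MeasurableSet.diff hB hA)
    Set.disjoint_sdiff_right
  rw [Set.union_sdiff_cancel hAB] at this
  exact le_self_add.trans this

lemma tsum_bellmanFunctional_le [IsProbabilityMeasure μ] (hp : 1 < p) (hf : Measurable f)
    (hF : ∫⁻ x, (f x : ℝ≥0∞) ^ p ∂μ ≠ ∞) (ht : ∫⁻ x, (f x : ℝ≥0∞) ∂μ ≠ ∞)
    (hα : IsCarlesonSequence μ ℱ C α) {n : ℕ} {ι : Type*} [Countable ι] {A : ι → Set X}
    (hA : ∀ i, MeasurableSet[ℱ n] (A i)) (hd : Pairwise (Function.onFun Disjoint A)) :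
    ∑' i, bellmanFunctional μ p C f α n (A i) ≤ bellmanFunctional μ p C f α n (⋃ i, A i) := by
  classical
  rw [ENNReal.tsum_eq_iSup_sum]
  refine iSup_le fun s => ?_
  have hs : ∀ s : Finset ι, MeasurableSet[ℱ n] (⋃ i ∈ s, A i) := fun s =>
    s.measurableSet_biUnion fun i _ => hA i
  have key : ∑ i ∈ s, bellmanFunctional μ p C f α n (A i) ≤
      bellmanFunctional μ p C f α n (⋃ i ∈ s, A i) := by
    induction s using Finset.induction_on with
    | empty => simp
    | insert i s hi ih =>
      rw [Finset.sum_insert hi, Finset.set_biUnion_insert]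
      refine (add_le_add_right ih _).trans (bellmanFunctional_add_le hp hf hF ht hα (hA i) (hs s) ?_)
      simp only [Set.disjoint_iUnion_right]
      intro j hj
      exact hd (fun h => hi (h ▸ hj))
  exact key.trans (bellmanFunctional_mono hp hf hF ht hα (hs s) (MeasurableSet.iUnion hA)
    (Set.iUnion₂_subset fun i _ => Set.subset_iUnion A i))

/-- Removing `α n` from the tail changes only the third coordinate of the state. The Carleson
condition at time `n` gives the room for the jump. -/
lemma bellmanFunctional_jump [IsProbabilityMeasure μ] (hp : 1 < p) (hf : Measurable f)
    (hF : ∫⁻ x, (f x : ℝ≥0∞) ^ p ∂μ ≠ ∞) (ht : ∫⁻ x, (f x : ℝ≥0∞) ∂μ ≠ ∞)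
    (hα : IsCarlesonSequence μ ℱ C α) {n : ℕ} {A : Set X} (hA : MeasurableSet[ℱ n] A) :
    (∫⁻ x in A, α n x ∂μ) * ((∫⁻ x in A, f x ∂μ) / μ A) ^ p +
      bellmanFunctional μ p C f α (n + 1) A ≤ bellmanFunctional μ p C f α n A := by
  by_cases h0 : μ A = 0
  · simp [Measure.restrict_eq_zero.2 h0, bellmanFunctional, bellmanPerspective, h0]
  have hm : (μ A).toNNReal ≠ 0 := by
    simp [ENNReal.toNNReal_eq_zero_iff, h0]
  have hμA : ((μ A).toNNReal : ℝ≥0∞) = μ A := ENNReal.coe_toNNReal (by finiteness)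
  have hsum : ∫⁻ x in A, tailSum α n x ∂μ =
      ∫⁻ x in A, α n x ∂μ + ∫⁻ x in A, tailSum α (n + 1) x ∂μ := by
    rw [← lintegral_add_left (hα.measurable n).coe_nnreal_ennreal]
    exact lintegral_congr fun x => tailSum_eq_add α n x
  have hfin := setLIntegral_ne_top (hα.lintegral_tailSum_ne_top n) A
  have ha : ∫⁻ x in A, α n x ∂μ ≠ ∞ := ne_top_of_le_ne_top hfin (hsum ▸ le_self_add)
  have hM : ∫⁻ x in A, tailSum α (n + 1) x ∂μ ≠ ∞ := ne_top_of_le_ne_top hfin (hsum ▸ le_add_self)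
  have hsum' : (∫⁻ x in A, tailSum α n x ∂μ).toNNReal = (∫⁻ x in A, α n x ∂μ).toNNReal +
      (∫⁻ x in A, tailSum α (n + 1) x ∂μ).toNNReal := by
    rw [hsum, ENNReal.toNNReal_add ha hM]
  have hA' : MeasurableSet[ℱ (n + 1)] A := ℱ.mono n.le_succ _ hA
  have hC : (∫⁻ x in A, α n x ∂μ).toNNReal + (∫⁻ x in A, tailSum α (n + 1) x ∂μ).toNNReal ≤
      C * (μ A).toNNReal := by
    rw [← hsum']
    have h := hα.setLIntegral_tailSum_le hA
    rw [← hμA, ← ENNReal.coe_mul] at h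
    exact (ENNReal.toNNReal_mono ENNReal.coe_ne_top h).trans (by simp)
  have := bellmanPerspective_jump hp (bellmanState_mem_cone hp hf hF ht hα hA') hC
  rw [ENNReal.coe_div hm, hμA, ENNReal.coe_toNNReal (setLIntegral_ne_top ht A),
    ENNReal.coe_toNNReal ha, ← hsum'] at this
  exact this

/-- The lower bound `c` passes to the average of `f` over `A`, so the conditional expectation is at
most `r` times this average. -/
lemma setLIntegral_mul_rpow_le_of_near_constant [IsProbabilityMeasure μ] (hp : 1 < p) (hα : IsCarlesonSequence μ ℱ C α)
    {n : ℕ} {A : Set X} (hA : MeasurableSet[ℱ n] A) {r c : ℝ≥0}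
    (hc : ∀ x ∈ A, (c : ℝ≥0∞) ≤ (μ⁻[fun y => (f y : ℝ≥0∞) | ℱ n]) x)
    (hc' : ∀ x ∈ A, (μ⁻[fun y => (f y : ℝ≥0∞) | ℱ n]) x ≤ r * c) :
    ∫⁻ x in A, (α n x : ℝ≥0∞) * (μ⁻[fun y => (f y : ℝ≥0∞) | ℱ n]) x ^ p ∂μ ≤
      (r : ℝ≥0∞) ^ p * ((∫⁻ x in A, α n x ∂μ) * ((∫⁻ x in A, f x ∂μ) / μ A) ^ p) := by
  have hp0 : 0 < p := by linarith
  have hA' := ℱ.le n _ hA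
  by_cases h0 : μ A = 0
  · simp [Measure.restrict_eq_zero.2 h0]
  have h1 : (c : ℝ≥0∞) ≤ (∫⁻ x in A, f x ∂μ) / μ A := by
    rw [ENNReal.le_div_iff_mul_le (.inl h0) (.inl (by finiteness)),
      ← setLIntegral_condLExp (ℱ.le n) μ _ hA, ← setLIntegral_const]
    exact setLIntegral_mono' hA' hc
  calc _ ≤ ∫⁻ x in A, (α n x : ℝ≥0∞) * ((r : ℝ≥0∞) * c) ^ p ∂μ := by
        refine setLIntegral_mono' hA' fun x hx => ?_
        gcongr
        exact hc' x hx
    _ = (r : ℝ≥0∞) ^ p * ((∫⁻ x in A, α n x ∂μ) * (c : ℝ≥0∞) ^ p) := by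
        rw [lintegral_mul_const _ (hα.measurable n).coe_nnreal_ennreal,
          ENNReal.mul_rpow_of_nonneg _ _ hp0.le]
        ring
    _ ≤ _ := by gcongr

/-- The main estimate: the Bellman functional dominates the partial sums. -/
lemma setLIntegral_sum_le_bellmanFunctional [IsProbabilityMeasure μ] (hp : 1 < p) (hf : Measurable f)
    (hF : ∫⁻ x, (f x : ℝ≥0∞) ^ p ∂μ ≠ ∞) (ht : ∫⁻ x, (f x : ℝ≥0∞) ∂μ ≠ ∞)
    (hα : IsCarlesonSequence μ ℱ C α) {r : ℝ≥0} (hr : 1 < r) (N : ℕ) :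
    ∀ (n : ℕ) (A : Set X), MeasurableSet[ℱ n] A →
      ∫⁻ x in A, ∑ k ∈ Finset.range N,
        (α (n + k) x : ℝ≥0∞) * (μ⁻[fun y => (f y : ℝ≥0∞) | ℱ (n + k)]) x ^ p ∂μ ≤
      (r : ℝ≥0∞) ^ p * bellmanFunctional μ p C f α n A := by
  have hp0 : 0 < p := by linarith
  induction N with
  | zero => intro n A hA; simp
  | succ N ih =>
    intro n A hA
    set g := μ⁻[fun y => (f y : ℝ≥0∞) | ℱ n] with hg
    have hgm : Measurable[ℱ n] g := measurable_condLExp _ _ _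
    have hgm' : Measurable g := measurable_condLExp' _ _ _
    set u : X → ℝ≥0∞ := fun x => ∑ k ∈ Finset.range (N + 1),
        (α (n + k) x : ℝ≥0∞) * (μ⁻[fun y => (f y : ℝ≥0∞) | ℱ (n + k)]) x ^ p with hu
    -- The term at time `n` and the induction hypothesis for the later terms carry the same factor
    -- `r ^ p`, so it does not accumulate over the `N` steps.
    have block : ∀ (B : Set X) (c : ℝ≥0), MeasurableSet[ℱ n] B → (∀ x ∈ B, (c : ℝ≥0∞) ≤ g x) →
        (∀ x ∈ B, g x ≤ r * c) →
        ∫⁻ x in B, u x ∂μ ≤ (r : ℝ≥0∞) ^ p * bellmanFunctional μ p C f α n B := by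
      intro B c hB h1 h2
      have hsplit : ∀ x, u x = (α n x : ℝ≥0∞) * g x ^ p + ∑ k ∈ Finset.range N,
          (α (n + 1 + k) x : ℝ≥0∞) * (μ⁻[fun y => (f y : ℝ≥0∞) | ℱ (n + 1 + k)]) x ^ p := by
        intro x
        rw [hu]
        simp only [Finset.sum_range_succ', add_zero]
        rw [add_comm]
        congr 1
        refine Finset.sum_congr rfl fun k _ => ?_
        rw [show n + (k + 1) = n + 1 + k by ring]
      simp_rw [hsplit]
      have hm1 : Measurable fun x => (α n x : ℝ≥0∞) * g x ^ p :=
        (hα.measurable n).coe_nnreal_ennreal.mul (hgm'.pow_const p)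
      rw [lintegral_add_left hm1]
      calc _ ≤ (r : ℝ≥0∞) ^ p * ((∫⁻ x in B, α n x ∂μ) * ((∫⁻ x in B, f x ∂μ) / μ B) ^ p) +
            (r : ℝ≥0∞) ^ p * bellmanFunctional μ p C f α (n + 1) B :=
            add_le_add (setLIntegral_mul_rpow_le_of_near_constant hp hα hB h1 h2)
              (ih (n + 1) B (ℱ.mono n.le_succ _ hB))
        _ ≤ _ := by
            rw [← mul_add]
            gcongr
            exact bellmanFunctional_jump hp hf hF ht hα hB
    have hr0 : r ≠ 0 := (zero_lt_one.trans hr).ne'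
    -- The logarithmic slices `U k` cover the points where `0 < g < ∞`. The zero set is a block with
    -- `c = 0`, and the set where `g` is infinite is null.
    set Z : Set X := A ∩ g ⁻¹' {0} with hZ
    set U : ℤ → Set X := fun k => A ∩ g ⁻¹' Set.Ico ((r : ℝ≥0∞) ^ k) ((r : ℝ≥0∞) ^ (k + 1)) with hU
    have hZm : MeasurableSet[ℱ n] Z := hA.inter (hgm (measurableSet_singleton 0))
    have hUm : ∀ k, MeasurableSet[ℱ n] (U k) := fun k => hA.inter (hgm measurableSet_Ico)
    have hUd : Pairwise (Function.onFun Disjoint U) := by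
      have hmono : Monotone fun k : ℤ => (r : ℝ≥0∞) ^ k := fun a b hab =>
        ENNReal.zpow_le_of_le (by exact_mod_cast hr.le) hab
      intro i j hij
      exact ((hmono.pairwise_disjoint_on_Ico_succ hij).preimage g).mono
        Set.inter_subset_right Set.inter_subset_right
    have hZU : Disjoint Z (⋃ k, U k) := by
      rw [Set.disjoint_left]
      rintro x ⟨_, hx⟩ hx'
      obtain ⟨k, _, hk⟩ := Set.mem_iUnion.1 hx'
      have : (r : ℝ≥0∞) ^ k ≤ 0 := by
        rw [← (show g x = 0 from hx)]; exact hk.1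
      exact (ENNReal.zpow_pos (by simpa using hr0) (by simp) k).not_ge this
    have hcover : A ⊆ (Z ∪ ⋃ k, U k) ∪ {x | g x = ∞} := by
      intro x hx
      by_cases h0 : g x = 0
      · exact .inl (.inl ⟨hx, h0⟩)
      by_cases hT : g x = ∞
      · exact .inr hT
      · obtain ⟨k, hk⟩ := ENNReal.exists_mem_Ico_zpow h0 hT
          (by exact_mod_cast hr : (1 : ℝ≥0∞) < r) (by simp)
        exact .inl (.inr (Set.mem_iUnion.2 ⟨k, hx, hk⟩))
    have hnull : μ {x | g x = ∞} = 0 := by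
      have := condLExp_ne_top (mΩ := ℱ n) ht
      rw [ae_iff] at this
      simpa using this
    calc ∫⁻ x in A, u x ∂μ ≤ ∫⁻ x in (Z ∪ ⋃ k, U k) ∪ {x | g x = ∞}, u x ∂μ :=
          lintegral_mono_set hcover
      _ ≤ ∫⁻ x in (Z ∪ ⋃ k, U k), u x ∂μ + ∫⁻ x in {x | g x = ∞}, u x ∂μ :=
          lintegral_union_le _ _ _
      _ = ∫⁻ x in Z, u x ∂μ + ∑' k, ∫⁻ x in U k, u x ∂μ := by
          rw [setLIntegral_measure_zero _ _ hnull, add_zero,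
            lintegral_union (MeasurableSet.iUnion fun k => ℱ.le n _ (hUm k)) hZU,
            lintegral_iUnion (fun k => ℱ.le n _ (hUm k)) hUd]
      _ ≤ (r : ℝ≥0∞) ^ p * bellmanFunctional μ p C f α n Z +
          ∑' k, (r : ℝ≥0∞) ^ p * bellmanFunctional μ p C f α n (U k) := by
          refine add_le_add (block Z 0 hZm (by simp) ?_) (ENNReal.tsum_le_tsum fun k => ?_)
          · rintro x ⟨_, hx⟩
            simpa using hx
          · refine block (U k) (r ^ k) (hUm k) ?_ ?_
            · rintro x ⟨_, hx⟩
              rw [ENNReal.coe_zpow hr0]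
              exact hx.1
            · rintro x ⟨_, hx⟩
              rw [ENNReal.coe_zpow hr0]
              refine hx.2.le.trans_eq ?_
              rw [ENNReal.zpow_add (by simpa using hr0) (by simp), zpow_one, mul_comm]
      _ = (r : ℝ≥0∞) ^ p * (bellmanFunctional μ p C f α n Z +
          ∑' k, bellmanFunctional μ p C f α n (U k)) := by
          rw [ENNReal.tsum_mul_left, mul_add]
      _ ≤ (r : ℝ≥0∞) ^ p * bellmanFunctional μ p C f α n A := by
          gcongr
          have hUm' := MeasurableSet.iUnion hUm
          refine (add_le_add_right (tsum_bellmanFunctional_le hp hf hF ht hα hUm hUd) _).trans ?_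
          refine (bellmanFunctional_add_le hp hf hF ht hα hZm hUm' hZU).trans ?_
          refine bellmanFunctional_mono hp hf hF ht hα (hZm.union hUm') hA ?_
          exact Set.union_subset Set.inter_subset_left
            (Set.iUnion_subset fun k => Set.inter_subset_left)

theorem martingaleBellman_le_dyadicBellman (μ : Measure X) [IsProbabilityMeasure μ]
    (ℱ : Filtration ℕ m) (hp : 1 < p) (I : ℤ × ℤ) (F t M C : ℝ≥0) :
    martingaleBellman μ ℱ p F t M C ≤ dyadicBellman p I F t M C := by
  refine sSup_le ?_
  rintro v ⟨f, α, hf, hF, ht, hM, hα, rfl⟩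
  have hF' : ∫⁻ x, (f x : ℝ≥0∞) ^ p ∂μ ≠ ∞ := by simp [hF]
  have ht' : ∫⁻ x, (f x : ℝ≥0∞) ∂μ ≠ ∞ := by simp [ht]
  -- The whole space has mass one, so its state at time `0` is the prescribed point.
  have hval : bellmanFunctional μ p C f α 0 Set.univ = infBellman p C (F, t, M) := by
    have hM' : ∫⁻ x, tailSum α 0 x ∂μ = M := by simpa [tailSum] using hM
    simp [bellmanFunctional, bellmanPerspective, bellmanState, hF, ht, hM']
  have hle : infBellman p C (F, t, M) ≤ dyadicBellman p I F t M C := iInf_le _ I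
  have hmeas : ∀ n, Measurable fun x =>
      (α n x : ℝ≥0∞) * (μ⁻[fun y => (f y : ℝ≥0∞) | ℱ n]) x ^ p := fun n =>
    (hα.measurable n).coe_nnreal_ennreal.mul ((measurable_condLExp' _ _ _).pow_const p)
  have key : ∀ r : ℝ≥0, 1 < r → ∫⁻ x, ∑' n : ℕ,
      (α n x : ℝ≥0∞) * (μ⁻[fun y => (f y : ℝ≥0∞) | ℱ n]) x ^ p ∂μ ≤
      (r : ℝ≥0∞) ^ p * dyadicBellman p I F t M C := by
    intro r hr
    rw [lintegral_tsum fun n => (hmeas n).aemeasurable, ENNReal.tsum_eq_iSup_nat]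
    refine iSup_le fun N => ?_
    rw [← lintegral_finsetSum _ fun n _ => hmeas n]
    have := setLIntegral_sum_le_bellmanFunctional hp hf hF' ht' hα hr N 0 Set.univ
      MeasurableSet.univ
    simp only [zero_add, setLIntegral_univ, hval] at this
    exact this.trans (by gcongr)
  have lim : Filter.Tendsto (fun r : ℝ≥0 => (r : ℝ≥0∞) ^ p * dyadicBellman p I F t M C)
      (nhdsWithin 1 (Set.Ioi 1)) (nhds (((1 : ℝ≥0) : ℝ≥0∞) ^ p * dyadicBellman p I F t M C)) := by
    refine ENNReal.Tendsto.mul_const ?_ (.inl (by simp))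
    exact ((ENNReal.continuous_rpow_const.comp ENNReal.continuous_coe).tendsto 1).mono_left
      nhdsWithin_le_nhds
  have := ge_of_tendsto lim (eventually_nhdsWithin_of_forall fun r hr => key r hr)
  simpa using this

end

/-! ### Almost even splittings in an infinitely refining filtration -/

section
variable {X : Type*} {m m0 : MeasurableSpace X}

/-- The pull-out property of the conditional expectation, in integrated form. -/
lemma lintegral_mul_condLExp (hm : m ≤ m0) (μ : Measure[m0] X) [IsFiniteMeasure μ]
    {G Y : X → ℝ≥0∞} (hG : Measurable[m] G) (hY : Measurable[m0] Y) :
    ∫⁻ x, G x * (μ⁻[Y | m]) x ∂μ = ∫⁻ x, G x * Y x ∂μ := by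
  have hc : Measurable[m0] (μ⁻[Y | m]) := measurable_condLExp' _ _ _
  have hG0 : Measurable[m0] G := hG.mono hm le_rfl
  -- The measures with densities `Y` and its conditional expectation agree on `m`, hence integrate
  -- every `m`-measurable `G` equally.
  have e : (μ.withDensity (μ⁻[Y | m])).trim hm = (μ.withDensity Y).trim hm := by
    refine @Measure.ext _ m _ _ fun s hs => ?_
    rw [trim_measurableSet_eq hm hs, trim_measurableSet_eq hm hs, withDensity_apply _ (hm s hs),
      withDensity_apply _ (hm s hs), setLIntegral_condLExp hm μ Y hs]
  have h1 := lintegral_withDensity_eq_lintegral_mul μ hc hG0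
  have h2 := lintegral_withDensity_eq_lintegral_mul μ hY hG0
  rw [← lintegral_trim hm hG] at h1 h2
  rw [e, h2] at h1
  simp only [Pi.mul_apply] at h1
  simp_rw [mul_comm (G _)]
  exact h1.symm

lemma setLIntegral_eq_lintegral_mul_condLExp (hm : m ≤ m0) (μ : Measure[m0] X) [IsFiniteMeasure μ]
    {G : X → ℝ≥0∞} (hG : Measurable[m] G) {S : Set X} (hS : MeasurableSet[m0] S) :
    ∫⁻ x in S, G x ∂μ = ∫⁻ x, G x * (μ⁻[S.indicator 1 | m]) x ∂μ := by
  rw [lintegral_mul_condLExp hm μ hG (measurable_one.indicator hS), ← lintegral_indicator hS]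
  refine lintegral_congr fun x => ?_
  by_cases hx : x ∈ S <;> simp [hx]
end

section
variable {X : Type*} {m : MeasurableSpace X}

/-- The conditional probability of `S` is `(1 + h_n) / 2` on `E` and zero off `E`, so multiplication
by `1 / (1 + |h_n|)` brings it down to at most one half. Only `|H|` matters, so one weight serves
both `h` and `-h`, that is, both pieces of a splitting. -/
lemma setLIntegral_weight_mul_le {μ : Measure X} [IsProbabilityMeasure μ] {ℱ : Filtration ℕ m}
    {n : ℕ} {E S : Set X} (hE : MeasurableSet[ℱ n] E) (hS : MeasurableSet S)
    {h H : X → ℝ} (hH : Measurable[ℱ n] H) (hh : Integrable h μ)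
    (hHh : ∀ᵐ x ∂μ, |(μ[h | ℱ n]) x| = |H x|)
    (hSE : ∀ x, S.indicator (fun _ => (1 : ℝ)) x =
      2⁻¹ * (E.indicator (fun _ => (1 : ℝ)) x + E.indicator h x))
    {G : X → ℝ≥0∞} (hG : Measurable[ℱ n] G) :
    ∫⁻ x in S, G x * ENNReal.ofReal (1 / (1 + |H x|)) ∂μ ≤ 2⁻¹ * ∫⁻ x in E, G x ∂μ := by
  have hm := ℱ.le n
  have hE' := hm _ hE
  set w : X → ℝ≥0∞ := fun x => ENNReal.ofReal (1 / (1 + |H x|)) with hw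
  have hwm : Measurable[ℱ n] w := by
    have : Measurable[ℱ n] fun x => |H x| := continuous_abs.measurable.comp hH
    exact ((measurable_const.div (measurable_const.add this))).ennreal_ofReal
  have h1E : Integrable (E.indicator fun _ => (1 : ℝ)) μ := (integrable_const 1).indicator hE'
  have hhE : Integrable (E.indicator h) μ := hh.indicator hE'
  have hq : ∀ᵐ x ∂μ, (μ⁻[S.indicator 1 | ℱ n]) x =
      ENNReal.ofReal (2⁻¹ * (E.indicator (fun _ => (1 : ℝ)) x + E.indicator (μ[h | ℱ n]) x)) := by
    have hS1 : Integrable (S.indicator fun _ => (1 : ℝ)) μ := (integrable_const 1).indicator hS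
    have e1 : (S.indicator 1 : X → ℝ≥0∞) =
        fun x => ENNReal.ofReal (S.indicator (fun _ => (1 : ℝ)) x) := by
      ext x; by_cases hx : x ∈ S <;> simp [hx]
    have e2 : (S.indicator fun _ => (1 : ℝ)) =
        (2⁻¹ : ℝ) • (E.indicator (fun _ => (1 : ℝ)) + E.indicator h) := by
      ext x; simpa using hSE x
    have k1 := condLExp_ofReal (ℱ n) hS1
      (.of_forall fun x => Set.indicator_nonneg (fun _ _ => zero_le_one) x)
    rw [e1]
    have k2 : μ[S.indicator (fun _ => (1 : ℝ)) | ℱ n] =ᵐ[μ]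
        (2⁻¹ : ℝ) • μ[E.indicator (fun _ => (1 : ℝ)) + E.indicator h | ℱ n] := by
      rw [e2]; exact condExp_smul _ _ _
    have k3 := condExp_add h1E hhE (ℱ n)
    have k4 := condExp_indicator hh hE
    have k5 : μ[E.indicator (fun _ => (1 : ℝ)) | ℱ n] = E.indicator (fun _ => (1 : ℝ)) :=
      condExp_of_stronglyMeasurable hm
        ((measurable_const.indicator hE).stronglyMeasurable) h1E
    filter_upwards [k1, k2, k3, k4] with x k1 k2 k3 k4
    rw [k1, k2, Pi.smul_apply, k3, Pi.add_apply, k4, k5, smul_eq_mul]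
  calc ∫⁻ x in S, G x * w x ∂μ = ∫⁻ x, G x * w x * (μ⁻[S.indicator 1 | ℱ n]) x ∂μ :=
        setLIntegral_eq_lintegral_mul_condLExp hm μ (hG.mul hwm) hS
    _ ≤ ∫⁻ x, E.indicator (fun x => 2⁻¹ * G x) x ∂μ := by
        refine lintegral_mono_ae ?_
        filter_upwards [hq, hHh] with x hx hx'
        rw [hx]
        by_cases hxE : x ∈ E
        · simp only [hxE, Set.indicator_of_mem]
          rw [mul_comm (2⁻¹ : ℝ≥0∞), mul_assoc]
          gcongr
          rw [hw, ← ENNReal.ofReal_mul (by positivity)]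
          have : (2⁻¹ : ℝ≥0∞) = ENNReal.ofReal 2⁻¹ := by
            rw [ENNReal.ofReal_inv_of_pos (by norm_num)]; simp
          rw [this]
          refine ENNReal.ofReal_le_ofReal ?_
          rw [← hx']
          have hpos : 0 < 1 + |(μ[h | ℱ n]) x| := by positivity
          rw [one_div, inv_mul_le_iff₀ hpos]
          nlinarith [le_abs_self ((μ[h | ℱ n]) x)]
        · simp [hxE]
    _ = _ := by
        rw [lintegral_indicator hE', lintegral_const_mul _ (hG.mono hm le_rfl)]

/-- In an infinitely refining filtration, a set can be cut into two pieces that are almost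
conditionally equal. The weight `w` compensates for the inequality. -/
lemma IsInfinitelyRefining.exists_split {μ : Measure X} [IsProbabilityMeasure μ]
    {ℱ : Filtration ℕ m} (h : IsInfinitelyRefining μ ℱ) {ε : ℝ≥0} (hε : 0 < ε) {n : ℕ} {E : Set X}
    (hE : MeasurableSet[ℱ n] E) :
    ∃ k, n < k ∧ ∃ E₁ E₂ : Set X, MeasurableSet[ℱ k] E₁ ∧ MeasurableSet[ℱ k] E₂ ∧
      Disjoint E₁ E₂ ∧ E₁ ∪ E₂ = E ∧ ∃ w w' : X → ℝ≥0, Measurable[ℱ n] w ∧ Measurable[ℱ n] w' ∧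
      (∀ x, w x + w' x = 1) ∧ ∫⁻ x in E, w' x ∂μ ≤ ε ∧
      (∀ G : X → ℝ≥0∞, Measurable[ℱ n] G → ∫⁻ x in E₁, G x * w x ∂μ ≤ 2⁻¹ * ∫⁻ x in E, G x ∂μ) ∧
      (∀ G : X → ℝ≥0∞, Measurable[ℱ n] G →
        ∫⁻ x in E₂, G x * w x ∂μ ≤ 2⁻¹ * ∫⁻ x in E, G x ∂μ) := by
  obtain ⟨k, hk, h, hhm, hhi, hh1, hhε⟩ := h ε (by exact_mod_cast hε) n E hE
  have hEk : MeasurableSet[ℱ k] E := ℱ.mono hk.le _ hE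
  have hpm : ∀ x ∈ E, h x = 1 ∨ h x = -1 := by
    intro x hx
    have := hh1 x
    simp only [hx, Set.indicator_of_mem] at this
    exact eq_or_eq_neg_of_abs_eq this
  set E₁ : Set X := E ∩ h ⁻¹' {1} with hE₁
  set E₂ : Set X := E ∩ h ⁻¹' {-1} with hE₂
  have m1 : MeasurableSet[ℱ k] E₁ := hEk.inter (hhm (measurableSet_singleton 1))
  have m2 : MeasurableSet[ℱ k] E₂ := hEk.inter (hhm (measurableSet_singleton (-1)))
  have hH : Measurable[ℱ n] (μ[h | ℱ n]) := stronglyMeasurable_condExp.measurable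
  set H := μ[h | ℱ n] with hHdef
  have habs : Measurable[ℱ n] fun x => |H x| := continuous_abs.measurable.comp hH
  refine ⟨k, hk, E₁, E₂, m1, m2, ?_, ?_, fun x => (1 / (1 + |H x|)).toNNReal,
    fun x => (|H x| / (1 + |H x|)).toNNReal, ?_, ?_, ?_, ?_, ?_, ?_⟩
  · rw [Set.disjoint_left]
    rintro x ⟨_, h1⟩ ⟨_, h2⟩
    simp only [Set.mem_preimage, Set.mem_singleton_iff] at h1 h2
    linarith
  · rw [hE₁, hE₂, ← Set.inter_union_distrib_left, Set.inter_eq_left]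
    exact fun x hx => hpm x hx
  · exact (measurable_const.div (measurable_const.add habs)).real_toNNReal
  · exact (habs.div (measurable_const.add habs)).real_toNNReal
  · intro x
    rw [← Real.toNNReal_add (by positivity) (by positivity), ← add_div, div_self (by positivity)]
    simp
  · calc ∫⁻ x in E, ((|H x| / (1 + |H x|)).toNNReal : ℝ≥0∞) ∂μ
        ≤ ∫⁻ x in E, ENNReal.ofReal |H x| ∂μ := by
          refine lintegral_mono fun x => ENNReal.ofReal_le_ofReal ?_
          exact div_le_self (abs_nonneg _) (by linarith [abs_nonneg (H x)])
      _ = ENNReal.ofReal (∫ x in E, |H x| ∂μ) := by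
          rw [ofReal_integral_eq_lintegral_ofReal]
          · exact integrable_condExp.abs.integrableOn
          · exact .of_forall fun x => abs_nonneg _
      _ ≤ ε := ENNReal.ofReal_le_of_le_toReal hhε
  · intro G hG
    refine setLIntegral_weight_mul_le (h := h) hE (ℱ.le k _ m1) hH hhi (.of_forall fun x => rfl)
      (fun x => ?_) hG
    by_cases hx : x ∈ E
    · rcases hpm x hx with h1 | h1
      · simp [hx, h1, hE₁]; norm_num
      · simp [hx, h1, hE₁]; norm_num
    · simp [hx, hE₁]
  · intro G hG
    refine setLIntegral_weight_mul_le (h := -h) hE (ℱ.le k _ m2) hH hhi.neg ?_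
      (fun x => ?_) hG
    · filter_upwards [condExp_neg h (ℱ n) (μ := μ)] with x hx
      rw [hx, Pi.neg_apply, abs_neg]
    by_cases hx : x ∈ E
    · rcases hpm x hx with h1 | h1
      · simp [hx, h1, hE₂]; norm_num
      · simp [hx, h1, hE₂]; norm_num
    · simp [hx, hE₂]

/-- Testing with `G = 1` bounds the integral of `w` over `S`; the remaining part `w'` costs at most
`ε`. -/
lemma measure_le_half_add {μ : Measure X} {ℱ : Filtration ℕ m} {n : ℕ} {E S : Set X}
    {w w' : X → ℝ≥0} (hw : Measurable w) (hww : ∀ x, w x + w' x = 1) {ε : ℝ≥0∞} (hS : S ⊆ E)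
    (hε : ∫⁻ x in E, w' x ∂μ ≤ ε)
    (hG : ∀ G : X → ℝ≥0∞, Measurable[ℱ n] G →
      ∫⁻ x in S, G x * w x ∂μ ≤ 2⁻¹ * ∫⁻ x in E, G x ∂μ) : μ S ≤ 2⁻¹ * μ E + ε :=
  calc μ S = ∫⁻ x in S, (w x : ℝ≥0∞) ∂μ + ∫⁻ x in S, w' x ∂μ := by
        rw [← lintegral_add_left hw.coe_nnreal_ennreal, ← setLIntegral_one]
        refine lintegral_congr fun x => ?_
        rw [← ENNReal.coe_add, hww, ENNReal.coe_one]
    _ ≤ 2⁻¹ * μ E + ε := by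
        gcongr
        · simpa using hG (fun _ => 1) measurable_const
        · exact (lintegral_mono_set hS).trans hε

/-- The random variable whose expectation is maximized in the martingale Bellman function. -/
noncomputable def embeddingSum (μ : Measure X) (ℱ : Filtration ℕ m) (p : ℝ) (f : X → ℝ≥0)
    (α : ℕ → X → ℝ≥0) (x : X) : ℝ≥0∞ :=
  ∑' j, (α j x : ℝ≥0∞) * (μ⁻[fun y => (f y : ℝ≥0∞) | ℱ j]) x ^ p

lemma measurable_embeddingSum (μ : Measure X) (ℱ : Filtration ℕ m) (p : ℝ) (f : X → ℝ≥0)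
    {α : ℕ → X → ℝ≥0} (hα : ∀ j, Measurable (α j)) : Measurable (embeddingSum μ ℱ p f α) :=
  Measurable.tsum fun j =>
    (hα j).coe_nnreal_ennreal.mul ((measurable_condLExp' _ _ _).pow_const p)

/-! ### Approximate realizations and their gluing -/

/-- Approximate realizations, on a set `E` of the `σ`-algebra `ℱ n`, of a point `(F, t, M)` and of
a value `v` of the functional that is maximized in the martingale Bellman function. -/
structure Approximant (μ : Measure X) (ℱ : Filtration ℕ m) (p : ℝ) (C : ℝ≥0) (n : ℕ) (E : Set X)
    (K F t M v δ : ℝ≥0) (f : X → ℝ≥0) (α : ℕ → X → ℝ≥0) : Prop where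
  measurable : Measurable f
  le_bound : ∀ x, f x ≤ K
  eq_zero : ∀ x, x ∉ E → f x = 0
  lintegral_le : ∫⁻ x, f x ∂μ ≤ t * μ E + δ
  le_lintegral : t * μ E ≤ ∫⁻ x, f x ∂μ + δ
  lintegral_rpow_le : ∫⁻ x, (f x : ℝ≥0∞) ^ p ∂μ ≤ F * μ E + δ
  adapted : ∀ j, Measurable[ℱ j] (α j)
  weight_eq_zero : ∀ j < n, ∀ x, α j x = 0
  mass_le : ∀ G : X → ℝ≥0∞, Measurable[ℱ n] G →
    ∫⁻ x, G x * tailSum α 0 x ∂μ ≤ M * ∫⁻ x in E, G x ∂μ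
  carleson : ∀ j, ∀ G : X → ℝ≥0∞, Measurable[ℱ (max n j)] G →
    ∫⁻ x, G x * tailSum α j x ∂μ ≤ C * ∫⁻ x in E, G x ∂μ
  le_value : v * μ E ≤ ∫⁻ x, embeddingSum μ ℱ p f α x ∂μ + δ

/-- Points and values that can be realized approximately on all sets, with a uniform bound for
the functions involved. -/
def Approximable (μ : Measure X) (ℱ : Filtration ℕ m) (p : ℝ) (C F t M v : ℝ≥0) : Prop :=
  ∃ K : ℝ≥0, ∀ (n : ℕ) (E : Set X), MeasurableSet[ℱ n] E → ∀ δ : ℝ≥0, 0 < δ →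
    ∃ f α, Approximant μ ℱ p C n E K F t M v δ f α

/-- These are the leaves of the construction: a constant function on `E` with no weights. The third
component `M` is only an upper bound for an approximant, so zero mass is allowed. -/
lemma approximable_of_rpow_le {μ : Measure X} {ℱ : Filtration ℕ m} {p : ℝ} (hp : 0 < p)
    {C F t M : ℝ≥0} (h : t ^ p ≤ F) : Approximable μ ℱ p C F t M 0 := by
  refine ⟨t, fun n E hE δ hδ => ⟨E.indicator fun _ => t, fun _ _ => 0, ?_⟩⟩
  have hE' := ℱ.le n _ hE
  have hint : ∫⁻ x, ((E.indicator (fun _ => t) x : ℝ≥0) : ℝ≥0∞) ∂μ = t * μ E := by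
    rw [← setLIntegral_const, ← lintegral_indicator hE']
    refine lintegral_congr fun x => ?_
    by_cases hx : x ∈ E <;> simp [hx]
  refine ⟨measurable_const.indicator hE', fun x => Set.indicator_le_self' (by simp) x,
    fun x hx => by simp [hx], ?_, ?_, ?_, fun j => measurable_const, by simp, ?_, ?_, by simp⟩
  · rw [hint]; exact le_self_add
  · rw [hint]; exact le_self_add
  · refine le_trans ?_ (le_self_add)
    calc ∫⁻ x, ((E.indicator (fun _ => t) x : ℝ≥0) : ℝ≥0∞) ^ p ∂μ
        = ((t ^ p : ℝ≥0) : ℝ≥0∞) * μ E := by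
          rw [← setLIntegral_const, ← lintegral_indicator hE']
          refine lintegral_congr fun x => ?_
          by_cases hx : x ∈ E
          · simp [hx, ENNReal.coe_rpow_of_nonneg _ hp.le]
          · simp [hx, hp]
      _ ≤ F * μ E := by gcongr
  · intro G hG; simp [tailSum]
  · intro j G hG; simp [tailSum]

end

section
variable {X : Type*} {m : MeasurableSpace X} {μ : Measure X} [IsProbabilityMeasure μ]
  {ℱ : Filtration ℕ m} {p : ℝ} {C : ℝ≥0}

/-- Jensen's inequality that tolerates an error: integrating the tangent line at `t` over `E` turns
a defect `δ` of the integral into `δ` times the slope `p * t ^ (p - 1)`. -/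
lemma rpow_mul_measure_le_setLIntegral_condLExp (hp : 1 < p) {n : ℕ} {E : Set X}
    (hE : MeasurableSet[ℱ n] E) {f : X → ℝ≥0} (hf0 : ∀ x, x ∉ E → f x = 0)
    {t : ℝ≥0} {δ : ℝ≥0∞} (h : t * μ E ≤ ∫⁻ x, f x ∂μ + δ) :
    (t : ℝ≥0∞) ^ p * μ E ≤ ∫⁻ x in E, (μ⁻[fun y => (f y : ℝ≥0∞) | ℱ n]) x ^ p ∂μ +
      p.toNNReal * (t : ℝ≥0∞) ^ (p - 1) * δ := by
  have hp0 : 0 < p := by linarith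
  have hE' := ℱ.le n _ hE
  set g := μ⁻[fun y => (f y : ℝ≥0∞) | ℱ n] with hg
  have hgm : Measurable g := measurable_condLExp' _ _ _
  have hint : ∫⁻ x in E, g x ∂μ = ∫⁻ x, f x ∂μ := by
    rw [hg, setLIntegral_condLExp (ℱ.le n) μ _ hE, ← lintegral_indicator hE']
    refine lintegral_congr fun x => ?_
    by_cases hx : x ∈ E
    · simp [hx]
    · simp [hx, hf0 x hx]
  have h1 := lintegral_mono (μ := μ.restrict E) fun x => tangent_le_rpow hp t (g x)
  rw [lintegral_const_mul _ hgm, lintegral_add_right _ measurable_const, setLIntegral_const,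
    hint] at h1
  have e1 : (t : ℝ≥0∞) ^ (p - 1) * t = (t : ℝ≥0∞) ^ p := by
    rw [← ENNReal.coe_rpow_of_nonneg _ hp0.le,
      ← ENNReal.coe_rpow_of_nonneg _ (by linarith : 0 ≤ p - 1), ← ENNReal.coe_mul]
    congr 1
    rcases eq_or_ne t 0 with rfl | h0
    · simp [hp0.ne']
    · rw [← NNReal.rpow_add_one h0]; simp
  have e2 : (p.toNNReal : ℝ≥0∞) = (p - 1).toNNReal + 1 := by
    norm_cast
    rw [← Real.toNNReal_one, ← Real.toNNReal_add (by linarith) (by norm_num)]; simp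
  refine (ENNReal.add_le_add_iff_right
    (by finiteness : ((p - 1).toNNReal * (t : ℝ≥0∞) ^ p * μ E) ≠ ∞)).1 ?_
  calc (t : ℝ≥0∞) ^ p * μ E + (p - 1).toNNReal * (t : ℝ≥0∞) ^ p * μ E
      = p.toNNReal * (t : ℝ≥0∞) ^ (p - 1) * (t * μ E) := by rw [← e1, e2]; ring
    _ ≤ p.toNNReal * (t : ℝ≥0∞) ^ (p - 1) * (∫⁻ x, f x ∂μ + δ) := by gcongr
    _ = p.toNNReal * (t : ℝ≥0∞) ^ (p - 1) * ∫⁻ x, f x ∂μ +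
        p.toNNReal * (t : ℝ≥0∞) ^ (p - 1) * δ := by rw [mul_add]
    _ ≤ (∫⁻ x in E, g x ^ p ∂μ + (p - 1).toNNReal * (t : ℝ≥0∞) ^ p * μ E) +
        p.toNNReal * (t : ℝ≥0∞) ^ (p - 1) * δ := by gcongr
    _ = _ := by ring

/-- The price of multiplying the weights by `w`. As `f ≤ K`, all conditional expectations are at
most `K`, and the mass bound tested against `w'` controls what is lost. -/
lemma Approximant.lintegral_embeddingSum_le (hp : 0 < p) {n k : ℕ} (hnk : n ≤ k) {E : Set X}
    {K F t M v δ : ℝ≥0} {f : X → ℝ≥0} {α : ℕ → X → ℝ≥0}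
    (h : Approximant μ ℱ p C k E K F t M v δ f α) {w w' : X → ℝ≥0} (hw : Measurable[ℱ n] w)
    (hw' : Measurable[ℱ n] w') (hww : ∀ x, w x + w' x = 1) :
    ∫⁻ x, embeddingSum μ ℱ p f α x ∂μ ≤ ∫⁻ x, w x * embeddingSum μ ℱ p f α x ∂μ +
      (K : ℝ≥0∞) ^ p * M * ∫⁻ x in E, w' x ∂μ := by
  have hα : ∀ j, Measurable (α j) := fun j => (h.adapted j).mono (ℱ.le j) le_rfl
  have hw0 : Measurable w := hw.mono (ℱ.le n) le_rfl
  have hw0' : Measurable w' := hw'.mono (ℱ.le n) le_rfl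
  have hS := measurable_embeddingSum μ ℱ p f hα
  have hb : ∀ᵐ x ∂μ, ∀ j, (μ⁻[fun y => (f y : ℝ≥0∞) | ℱ j]) x ≤ K := by
    rw [ae_all_iff]
    intro j
    have h1 := condLExp_mono (mΩ := ℱ j) (P := μ) (X := fun y => (f y : ℝ≥0∞))
      (Y := fun _ => (K : ℝ≥0∞)) (.of_forall fun x => ENNReal.coe_le_coe.2 (h.le_bound x))
    rw [condLExp_const (ℱ.le j)] at h1
    exact h1
  calc ∫⁻ x, embeddingSum μ ℱ p f α x ∂μ
      = ∫⁻ x, w x * embeddingSum μ ℱ p f α x ∂μ + ∫⁻ x, w' x * embeddingSum μ ℱ p f α x ∂μ := by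
        rw [← lintegral_add_left (hw0.coe_nnreal_ennreal.fun_mul hS)]
        refine lintegral_congr fun x => ?_
        rw [← add_mul, ← ENNReal.coe_add, hww, ENNReal.coe_one, one_mul]
    _ ≤ _ := by
        gcongr
        calc ∫⁻ x, w' x * embeddingSum μ ℱ p f α x ∂μ
            ≤ ∫⁻ x, (K : ℝ≥0∞) ^ p * (w' x * tailSum α 0 x) ∂μ := by
              refine lintegral_mono_ae ?_
              filter_upwards [hb] with x hx
              rw [mul_left_comm, tailSum, ← ENNReal.tsum_mul_left]
              gcongr
              refine ENNReal.tsum_le_tsum fun j => ?_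
              rw [zero_add, mul_comm]
              gcongr
              exact hx j
          _ = (K : ℝ≥0∞) ^ p * ∫⁻ x, w' x * tailSum α 0 x ∂μ :=
              lintegral_const_mul _ (hw0'.coe_nnreal_ennreal.mul (measurable_tailSum hα 0))
          _ ≤ _ := by
              rw [mul_assoc]
              gcongr
              exact h.mass_le _ (hw'.mono (ℱ.mono hnk) le_rfl).coe_nnreal_ennreal

/-- The counterpart of gluing on dyadic halves: split `E`, realize the two points on the pieces,
damp their weights by `w`, and add the constant `a` on `E` at time `n`. The Carleson condition
survives without error. Up to time `n` it is the mass bound, and after `n` it follows from the two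
pieces and `w ≤ 1`. -/
lemma Approximable.node (hR : IsInfinitelyRefining μ ℱ) (hp : 1 < p)
    {a F₁ t₁ M₁ v₁ F₂ t₂ M₂ v₂ : ℝ≥0} (A₁ : Approximable μ ℱ p C F₁ t₁ M₁ v₁)
    (A₂ : Approximable μ ℱ p C F₂ t₂ M₂ v₂) (hC : a + (M₁ + M₂) / 2 ≤ C) :
    Approximable μ ℱ p C ((F₁ + F₂) / 2) ((t₁ + t₂) / 2) (a + (M₁ + M₂) / 2)
      (a * ((t₁ + t₂) / 2) ^ p + (v₁ + v₂) / 2) := by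
  have hp0 : 0 < p := by linarith
  obtain ⟨K₁, A₁⟩ := A₁
  obtain ⟨K₂, A₂⟩ := A₂
  refine ⟨K₁ + K₂, fun n E hE δ hδ => ?_⟩
  have hE' := ℱ.le n _ hE
  set t : ℝ≥0 := (t₁ + t₂) / 2 with htdef
  -- `L₀` gathers the errors in the value: the Jensen defect at the top, the errors of the two
  -- pieces and of their measures, and the loss from `w`. `L` adds the errors in `t` and `F`. Since
  -- `L` involves `K₁` and `K₂`, these bounds have to be fixed before the splitting is.
  set L₀ : ℝ≥0 := a * (p.toNNReal * t ^ (p - 1) * (2 + t₁ + t₂)) + (2 + v₁ + v₂) +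
    (K₁ ^ p * M₁ + K₂ ^ p * M₂) with hL₀
  set L : ℝ≥0 := L₀ + (2 + t₁ + t₂) + (2 + F₁ + F₂) with hL
  have hLpos : 0 < L := by positivity
  set ε : ℝ≥0 := δ / L with hε
  have hεpos : 0 < ε := div_pos hδ hLpos
  have hεL : ε * L = δ := div_mul_cancel₀ _ hLpos.ne'
  have hεt : ε * (2 + t₁ + t₂) ≤ δ := by
    rw [← hεL]; gcongr; rw [hL, add_assoc, add_comm L₀, add_assoc]; exact le_self_add
  have hεF : ε * (2 + F₁ + F₂) ≤ δ := by
    rw [← hεL]; gcongr; rw [hL]; exact le_add_self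
  have hε0 : ε * L₀ ≤ δ := by
    rw [← hεL]; gcongr; rw [hL, add_assoc]; exact le_self_add
  obtain ⟨k, hk, E₁, E₂, hE₁, hE₂, hdisj, hunion, w, w', hw, hw', hww, hwε, hG₁, hG₂⟩ :=
    hR.exists_split hεpos hE
  obtain ⟨f₁, α₁, H₁⟩ := A₁ k E₁ hE₁ ε hεpos
  obtain ⟨f₂, α₂, H₂⟩ := A₂ k E₂ hE₂ ε hεpos
  have hE₂' := ℱ.le k _ hE₂
  have hw0 : Measurable w := hw.mono (ℱ.le n) le_rfl
  have hw1 : ∀ x, (w x : ℝ≥0∞) ≤ 1 := fun x => by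
    rw [← ENNReal.coe_one, ENNReal.coe_le_coe, ← hww x]; exact le_self_add
  have hsub₁ : E₁ ⊆ E := hunion ▸ Set.subset_union_left
  have hsub₂ : E₂ ⊆ E := hunion ▸ Set.subset_union_right
  have hμ : μ E = μ E₁ + μ E₂ := by rw [← hunion, measure_union hdisj hE₂']
  have up₁ := measure_le_half_add hw0 hww hsub₁ hwε hG₁
  have up₂ := measure_le_half_add hw0 hww hsub₂ hwε hG₂
  -- One piece being not too large prevents the other from being too small.
  have lower : ∀ x y : ℝ≥0∞, μ E = x + y → y ≤ 2⁻¹ * μ E + ε → 2⁻¹ * μ E ≤ x + ε := by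
    intro x y hxy hy
    refine (ENNReal.add_le_add_iff_right (by finiteness : 2⁻¹ * μ E ≠ ∞)).1 ?_
    calc 2⁻¹ * μ E + 2⁻¹ * μ E = μ E := by
          rw [← add_mul, ENNReal.inv_two_add_inv_two, one_mul]
      _ = x + y := hxy
      _ ≤ x + (2⁻¹ * μ E + ε) := by gcongr
      _ = _ := by ring
  have lo₁ := lower _ _ hμ up₂
  have lo₂ := lower _ _ (hμ.trans (add_comm _ _)) up₁
  have half_up : ∀ y₁ y₂ : ℝ≥0, y₁ * μ E₁ + ε + (y₂ * μ E₂ + ε) ≤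
      ((y₁ + y₂) / 2 : ℝ≥0) * μ E + (ε * (2 + y₁ + y₂) : ℝ≥0) := by
    intro y₁ y₂
    calc y₁ * μ E₁ + ε + (y₂ * μ E₂ + ε)
        ≤ y₁ * (2⁻¹ * μ E + ε) + ε + (y₂ * (2⁻¹ * μ E + ε) + ε) := by gcongr
      _ = _ := by rw [← inv_two_mul_coe_add]; push_cast; ring
  have half_lo : ∀ y₁ y₂ : ℝ≥0, ((y₁ + y₂) / 2 : ℝ≥0) * μ E ≤
      y₁ * μ E₁ + y₂ * μ E₂ + (ε * (y₁ + y₂) : ℝ≥0) := by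
    intro y₁ y₂
    calc ((y₁ + y₂) / 2 : ℝ≥0) * μ E = y₁ * (2⁻¹ * μ E) + y₂ * (2⁻¹ * μ E) := by
          rw [← inv_two_mul_coe_add]; ring
      _ ≤ y₁ * (μ E₁ + ε) + y₂ * (μ E₂ + ε) := by gcongr
      _ = _ := by push_cast; ring
  set f : X → ℝ≥0 := fun x => f₁ x + f₂ x with hf
  set α : ℕ → X → ℝ≥0 := fun j x =>
    (if j = n then E.indicator (fun _ => a) x else 0) + w x * (α₁ j x + α₂ j x) with hα
  have hα₁ : ∀ j, Measurable (α₁ j) := fun j => (H₁.adapted j).mono (ℱ.le j) le_rfl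
  have hα₂ : ∀ j, Measurable (α₂ j) := fun j => (H₂.adapted j).mono (ℱ.le j) le_rfl
  have hαm : ∀ j, Measurable[ℱ j] (α j) := by
    intro j
    rcases lt_or_ge j n with hj | hj
    · have : α j = fun _ => 0 := by
        ext x
        simp [hα, hj.ne, H₁.weight_eq_zero j (hj.trans hk), H₂.weight_eq_zero j (hj.trans hk)]
      rw [this]; exact measurable_const
    · have hwj : Measurable[ℱ j] w := hw.mono (ℱ.mono hj) le_rfl
      refine Measurable.add ?_ (hwj.mul ((H₁.adapted j).add (H₂.adapted j)))
      by_cases hjn : j = n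
      · subst hjn
        simp only [if_true]
        exact measurable_const.indicator hE
      · simp only [hjn, if_false]
        exact measurable_const
  have htail0 : ∀ x, tailSum α 0 x = E.indicator (fun _ => (a : ℝ≥0∞)) x +
      w x * (tailSum α₁ 0 x + tailSum α₂ 0 x) := by
    intro x
    simp only [tailSum, hα, zero_add]
    push_cast
    rw [ENNReal.tsum_add, ENNReal.tsum_mul_left, ENNReal.tsum_add]
    congr 1
    rw [tsum_eq_single n]
    · by_cases hx : x ∈ E <;> simp [hx]
    · intro j hj; simp [hj]
  have htail : ∀ j, n < j → ∀ x, tailSum α j x = w x * (tailSum α₁ j x + tailSum α₂ j x) := by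
    intro j hj x
    simp only [tailSum, hα]
    rw [← ENNReal.tsum_add, ← ENNReal.tsum_mul_left]
    refine tsum_congr fun i => ?_
    rw [if_neg (by omega), zero_add]
    push_cast
    rfl
  have htail_le : ∀ j x, tailSum α j x ≤ tailSum α 0 x := by
    intro j x
    simp only [tailSum, zero_add]
    exact ENNReal.tsum_comp_le_tsum_of_injective (add_right_injective j) fun i => (α i x : ℝ≥0∞)
  have hmass : ∀ G : X → ℝ≥0∞, Measurable[ℱ n] G →
      ∫⁻ x, G x * tailSum α 0 x ∂μ ≤ (a + (M₁ + M₂) / 2 : ℝ≥0) * ∫⁻ x in E, G x ∂μ := by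
    intro G hG
    have hG0 : Measurable G := hG.mono (ℱ.le n) le_rfl
    have hGw : Measurable[ℱ n] fun x => G x * (w x : ℝ≥0∞) := hG.mul hw.coe_nnreal_ennreal
    have hGw0 : Measurable fun x => G x * (w x : ℝ≥0∞) := hGw.mono (ℱ.le n) le_rfl
    have hGwk : Measurable[ℱ k] fun x => G x * (w x : ℝ≥0∞) := hGw.mono (ℱ.mono hk.le) le_rfl
    calc ∫⁻ x, G x * tailSum α 0 x ∂μ
        = ∫⁻ x in E, a * G x ∂μ + (∫⁻ x, G x * w x * tailSum α₁ 0 x ∂μ +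
            ∫⁻ x, G x * w x * tailSum α₂ 0 x ∂μ) := by
          rw [← lintegral_add_left (hGw0.fun_mul (measurable_tailSum hα₁ 0)), ← lintegral_indicator hE',
            ← lintegral_add_left ((hG0.const_mul _).indicator hE')]
          refine lintegral_congr fun x => ?_
          rw [htail0]
          by_cases hx : x ∈ E
          · simp only [hx, Set.indicator_of_mem]; ring
          · simp only [hx, not_false_eq_true, Set.indicator_of_notMem]; ring
      _ ≤ a * ∫⁻ x in E, G x ∂μ + (M₁ * (2⁻¹ * ∫⁻ x in E, G x ∂μ) +
            M₂ * (2⁻¹ * ∫⁻ x in E, G x ∂μ)) := by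
          rw [lintegral_const_mul _ hG0]
          gcongr
          · exact (H₁.mass_le _ hGwk).trans (by gcongr; exact hG₁ G hG)
          · exact (H₂.mass_le _ hGwk).trans (by gcongr; exact hG₂ G hG)
      _ = _ := by
          rw [ENNReal.coe_add, ← inv_two_mul_coe_add]; ring
  have hint : ∫⁻ x, f x ∂μ = ∫⁻ x, f₁ x ∂μ + ∫⁻ x, f₂ x ∂μ := by
    rw [← lintegral_add_left H₁.measurable.coe_nnreal_ennreal]
    simp [hf]
  have hlow : (t : ℝ≥0∞) * μ E ≤ ∫⁻ x, f x ∂μ + (ε * (2 + t₁ + t₂) : ℝ≥0) := by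
    refine (half_lo t₁ t₂).trans ?_
    rw [hint]
    calc _ ≤ (∫⁻ x, f₁ x ∂μ + ε) + (∫⁻ x, f₂ x ∂μ + ε) + (ε * (t₁ + t₂) : ℝ≥0) := by
          gcongr
          · exact H₁.le_lintegral
          · exact H₂.le_lintegral
      _ = _ := by push_cast; ring
  have hf0 : ∀ x, x ∉ E → f x = 0 := fun x hx => by
    simp [hf, H₁.eq_zero x fun h => hx (hsub₁ h), H₂.eq_zero x fun h => hx (hsub₂ h)]
  refine ⟨f, α, H₁.measurable.add H₂.measurable,
    fun x => add_le_add (H₁.le_bound x) (H₂.le_bound x), hf0, ?_, ?_, ?_, hαm, ?_, hmass, ?_, ?_⟩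
  · rw [hint]
    refine (add_le_add H₁.lintegral_le H₂.lintegral_le).trans ((half_up t₁ t₂).trans ?_)
    gcongr
  · exact hlow.trans (by gcongr)
  · have hsum : ∀ x, (f x : ℝ≥0∞) ^ p = (f₁ x : ℝ≥0∞) ^ p + (f₂ x : ℝ≥0∞) ^ p := by
      intro x
      by_cases hx : x ∈ E₁
      · have : f₂ x = 0 := H₂.eq_zero x (Set.disjoint_left.1 hdisj hx)
        simp [hf, this, hp0]
      · have : f₁ x = 0 := H₁.eq_zero x hx
        simp [hf, this, hp0]
    simp_rw [hsum]
    rw [lintegral_add_left (H₁.measurable.coe_nnreal_ennreal.pow_const p)]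
    refine (add_le_add H₁.lintegral_rpow_le H₂.lintegral_rpow_le).trans
      ((half_up F₁ F₂).trans ?_)
    gcongr
  · intro j hj x
    simp [hα, hj.ne, H₁.weight_eq_zero j (hj.trans hk), H₂.weight_eq_zero j (hj.trans hk)]
  · intro j G hG
    rcases le_or_gt j n with hj | hj
    · rw [max_eq_left hj] at hG
      calc ∫⁻ x, G x * tailSum α j x ∂μ ≤ ∫⁻ x, G x * tailSum α 0 x ∂μ := by
            refine lintegral_mono fun x => ?_
            gcongr
            exact htail_le j x
        _ ≤ _ := (hmass G hG).trans (by gcongr)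
    · rw [max_eq_right hj.le] at hG
      have hwj : Measurable[ℱ j] w := hw.mono (ℱ.mono hj.le) le_rfl
      have hGw : Measurable[ℱ j] fun x => G x * (w x : ℝ≥0∞) := hG.mul hwj.coe_nnreal_ennreal
      have hGw0 : Measurable fun x => G x * (w x : ℝ≥0∞) := hGw.mono (ℱ.le j) le_rfl
      have hGwk : Measurable[ℱ (max k j)] fun x => G x * (w x : ℝ≥0∞) :=
        hGw.mono (ℱ.mono (le_max_right _ _)) le_rfl
      calc ∫⁻ x, G x * tailSum α j x ∂μ = ∫⁻ x, G x * w x * tailSum α₁ j x ∂μ +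
            ∫⁻ x, G x * w x * tailSum α₂ j x ∂μ := by
            rw [← lintegral_add_left (hGw0.fun_mul (measurable_tailSum hα₁ j))]
            refine lintegral_congr fun x => ?_
            rw [htail j hj]
            ring
        _ ≤ C * ∫⁻ x in E₁, G x * w x ∂μ + C * ∫⁻ x in E₂, G x * w x ∂μ :=
            add_le_add (H₁.carleson j _ hGwk) (H₂.carleson j _ hGwk)
        _ = C * ∫⁻ x in E, G x * w x ∂μ := by
            rw [← mul_add, ← lintegral_union hE₂' hdisj, hunion]
        _ ≤ _ := by
            gcongr with x
            exact mul_le_of_le_one_right' (hw1 x)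
  · have hS₁ := measurable_embeddingSum μ ℱ p f₁ hα₁
    have hS₂ := measurable_embeddingSum μ ℱ p f₂ hα₂
    have hmono : ∀ f' : X → ℝ≥0, (∀ x, f' x ≤ f x) → ∀ᵐ x ∂μ, ∀ j,
        (μ⁻[fun y => (f' y : ℝ≥0∞) | ℱ j]) x ≤ (μ⁻[fun y => (f y : ℝ≥0∞) | ℱ j]) x := by
      intro f' hf'
      rw [ae_all_iff]
      exact fun j => condLExp_mono (.of_forall fun x => ENNReal.coe_le_coe.2 (hf' x))
    -- The conditional expectations of `f` dominate those of `f₁` and of `f₂`, so the contributions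
    -- of the pieces only grow.
    have hval : ∫⁻ x in E, a * (μ⁻[fun y => (f y : ℝ≥0∞) | ℱ n]) x ^ p ∂μ +
        (∫⁻ x, w x * embeddingSum μ ℱ p f₁ α₁ x ∂μ + ∫⁻ x, w x * embeddingSum μ ℱ p f₂ α₂ x ∂μ) ≤
        ∫⁻ x, embeddingSum μ ℱ p f α x ∂μ := by
      rw [← lintegral_add_left (hw0.coe_nnreal_ennreal.fun_mul hS₁), ← lintegral_indicator hE',
        ← lintegral_add_left ((((measurable_condLExp' _ _ _).pow_const p).const_mul _).indicator hE')]
      refine lintegral_mono_ae ?_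
      filter_upwards [hmono f₁ (fun x => le_self_add), hmono f₂ (fun x => le_add_self)] with x h1 h2
      simp only [embeddingSum, hα]
      push_cast
      simp_rw [add_mul, ENNReal.tsum_add, mul_assoc, ENNReal.tsum_mul_left, add_mul,
        ENNReal.tsum_add, mul_add]
      gcongr with j j
      · rw [tsum_eq_single n]
        · by_cases hx : x ∈ E <;> simp [hx]
        · intro j hj; simp [hj]
      · exact h1 j
      · exact h2 j
    have hloss₁ := H₁.lintegral_embeddingSum_le hp0 hk.le hw hw' hww
    have hloss₂ := H₂.lintegral_embeddingSum_le hp0 hk.le hw hw' hww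
    have htop := rpow_mul_measure_le_setLIntegral_condLExp hp hE hf0 hlow
    have hw₁ : ∫⁻ x in E₁, (w' x : ℝ≥0∞) ∂μ ≤ ε := (lintegral_mono_set hsub₁).trans hwε
    have hw₂ : ∫⁻ x in E₂, (w' x : ℝ≥0∞) ∂μ ≤ ε := (lintegral_mono_set hsub₂).trans hwε
    have hv₁ : v₁ * μ E₁ ≤ ∫⁻ x, w x * embeddingSum μ ℱ p f₁ α₁ x ∂μ +
        (K₁ : ℝ≥0∞) ^ p * M₁ * ε + ε := by
      refine H₁.le_value.trans ?_
      gcongr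
      exact hloss₁.trans (by gcongr)
    have hv₂ : v₂ * μ E₂ ≤ ∫⁻ x, w x * embeddingSum μ ℱ p f₂ α₂ x ∂μ +
        (K₂ : ℝ≥0∞) ^ p * M₂ * ε + ε := by
      refine H₂.le_value.trans ?_
      gcongr
      exact hloss₂.trans (by gcongr)
    have htop' : a * ((t : ℝ≥0∞) ^ p * μ E) ≤
        ∫⁻ x in E, a * (μ⁻[fun y => (f y : ℝ≥0∞) | ℱ n]) x ^ p ∂μ +
          a * (p.toNNReal * (t : ℝ≥0∞) ^ (p - 1) * (ε * (2 + t₁ + t₂) : ℝ≥0)) := by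
      rw [lintegral_const_mul _ ((measurable_condLExp' _ _ _).pow_const p), ← mul_add]
      gcongr
    calc ((a * t ^ p + (v₁ + v₂) / 2 : ℝ≥0) : ℝ≥0∞) * μ E
        = a * ((t : ℝ≥0∞) ^ p * μ E) + ((v₁ + v₂) / 2 : ℝ≥0) * μ E := by
          rw [ENNReal.coe_add, ENNReal.coe_mul, ENNReal.coe_rpow_of_nonneg _ hp0.le]; ring
      _ ≤ (∫⁻ x in E, a * (μ⁻[fun y => (f y : ℝ≥0∞) | ℱ n]) x ^ p ∂μ +
          a * (p.toNNReal * (t : ℝ≥0∞) ^ (p - 1) * (ε * (2 + t₁ + t₂) : ℝ≥0))) +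
          ((∫⁻ x, w x * embeddingSum μ ℱ p f₁ α₁ x ∂μ + (K₁ : ℝ≥0∞) ^ p * M₁ * ε + ε) +
          (∫⁻ x, w x * embeddingSum μ ℱ p f₂ α₂ x ∂μ + (K₂ : ℝ≥0∞) ^ p * M₂ * ε + ε) +
          (ε * (v₁ + v₂) : ℝ≥0)) := by
          refine add_le_add htop' ((half_lo v₁ v₂).trans ?_)
          gcongr
      _ = (∫⁻ x in E, a * (μ⁻[fun y => (f y : ℝ≥0∞) | ℱ n]) x ^ p ∂μ +
        (∫⁻ x, w x * embeddingSum μ ℱ p f₁ α₁ x ∂μ + ∫⁻ x, w x * embeddingSum μ ℱ p f₂ α₂ x ∂μ)) +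
          (ε * L₀ : ℝ≥0) := by
          rw [hL₀]
          push_cast
          rw [ENNReal.coe_rpow_of_nonneg _ hp0.le, ENNReal.coe_rpow_of_nonneg _ hp0.le,
            ENNReal.coe_rpow_of_nonneg _ (by linarith : 0 ≤ p - 1)]
          ring
      _ ≤ _ := by gcongr

end

/-! ### Transferring dyadic pairs to the filtration -/

lemma rpow_dyadicAverage_le {p : ℝ} (hp : 1 < p) {f : ℝ → ℝ≥0} (hf : Measurable f) {J : ℤ × ℤ}
    {F t : ℝ≥0} (hF : dyadicAverage (fun x => (f x : ℝ≥0∞) ^ p) J = F)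
    (ht : dyadicAverage (fun x => (f x : ℝ≥0∞)) J = t) : t ^ p ≤ F := by
  have hl := coe_dyadicLength_ne_zero J
  have hfin : IsFiniteMeasure (volume.restrict (dyadicInterval J)) :=
    ⟨by rw [Measure.restrict_apply_univ, volume_dyadicInterval]; exact ENNReal.coe_lt_top⟩
  have h := rpow_mul_measure_le hp (volume.restrict (dyadicInterval J)) hf.coe_nnreal_ennreal
    (t := t) (by
      rw [Measure.restrict_apply_univ, volume_dyadicInterval, ← ht, dyadicAverage_eq,
        mul_comm, ← mul_assoc, ENNReal.mul_inv_cancel hl ENNReal.coe_ne_top, one_mul])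
  rw [Measure.restrict_apply_univ, volume_dyadicInterval] at h
  rw [dyadicAverage_eq] at hF
  rw [← ENNReal.coe_le_coe, ENNReal.coe_rpow_of_nonneg _ (by linarith), ← hF, mul_comm,
    ← ENNReal.div_eq_inv_mul.trans (mul_comm _ _), ENNReal.le_div_iff_mul_le (.inl hl) (.inl ENNReal.coe_ne_top)]
  exact h

lemma exists_coe_of_inv_two_mul_add {x y : ℝ≥0∞} {z : ℝ≥0} (h : (2 : ℝ≥0∞)⁻¹ * (x + y) = z) :
    ∃ a b : ℝ≥0, x = a ∧ y = b ∧ z = (a + b) / 2 := by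
  have hxy : x + y ≠ ∞ := by
    intro h'
    rw [h', ENNReal.mul_top (by simp)] at h
    exact ENNReal.coe_ne_top h.symm
  obtain ⟨hx, hy⟩ := ENNReal.add_ne_top.1 hxy
  lift x to ℝ≥0 using hx
  lift y to ℝ≥0 using hy
  refine ⟨x, y, rfl, rfl, ?_⟩
  rw [inv_two_mul_coe_add] at h
  exact_mod_cast h.symm

section
variable {X : Type*} {m : MeasurableSpace X} {μ : Measure X} [IsProbabilityMeasure μ]
  {ℱ : Filtration ℕ m} {p : ℝ} {C : ℝ≥0}

/-- The truncation at scale `K` of the summands in the dyadic embedding sum. -/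
noncomputable def truncatedTerm (p : ℝ) (f : ℝ → ℝ≥0) (α : ℤ × ℤ → ℝ≥0) (K : ℤ) (J : ℤ × ℤ) :
    ℝ≥0∞ :=
  if K < J.1 then (α J : ℝ≥0∞) * dyadicAverage (fun x => (f x : ℝ≥0∞)) J ^ p else 0

/-- Induction on the number `N` of generations above the cutoff scale `K`. At or below that scale
the truncated sum is empty and a constant suffices; above it, the two halves are joined with `a = α
J / |J|`. -/
lemma approximable_of_dyadic (hR : IsInfinitelyRefining μ ℱ) (hp : 1 < p) {f : ℝ → ℝ≥0}
    (hf : Measurable f) {α : ℤ × ℤ → ℝ≥0} (hα : DyadicCarleson C α) (K : ℤ) (N : ℕ) :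
    ∀ (J : ℤ × ℤ) (F t M : ℝ≥0), J.1 ≤ K + N →
      dyadicAverage (fun x => (f x : ℝ≥0∞) ^ p) J = F →
      dyadicAverage (fun x => (f x : ℝ≥0∞)) J = t →
      (dyadicLength J : ℝ≥0∞)⁻¹ * sumBelow (fun J => (α J : ℝ≥0∞)) J = M →
      ∃ v : ℝ≥0, (dyadicLength J : ℝ≥0∞)⁻¹ * sumBelow (truncatedTerm p f α K) J = v ∧
        Approximable μ ℱ p C F t M v := by
  have hp0 : 0 < p := by linarith
  have base : ∀ (J : ℤ × ℤ) (F t M : ℝ≥0), J.1 ≤ K →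
      dyadicAverage (fun x => (f x : ℝ≥0∞) ^ p) J = F →
      dyadicAverage (fun x => (f x : ℝ≥0∞)) J = t →
      ∃ v : ℝ≥0, (dyadicLength J : ℝ≥0∞)⁻¹ * sumBelow (truncatedTerm p f α K) J = v ∧
        Approximable μ ℱ p C F t M v := by
    intro J F t M hJ hF ht
    refine ⟨0, ?_, approximable_of_rpow_le hp0 (rpow_dyadicAverage_le hp hf hF ht)⟩
    have : sumBelow (truncatedTerm p f α K) J = 0 := by
      rw [sumBelow, ENNReal.tsum_eq_zero]
      rintro ⟨J', hJ'⟩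
      exact if_neg (not_lt.2 ((fst_le_of_subset hJ').trans hJ))
    simp [this]
  induction N with
  | zero => intro J F t M hJ hF ht _; exact base J F t M (by simpa using hJ) hF ht
  | succ N ih =>
    intro J F t M hJ hF ht hM
    rcases le_or_gt J.1 K with hK | hK
    · exact base J F t M hK hF ht
    have hmass : ∀ J, (dyadicLength J : ℝ≥0∞)⁻¹ * sumBelow (fun J => (α J : ℝ≥0∞)) J ≤ C := by
      intro J
      have h := hα J
      rw [volume_dyadicInterval] at h
      rw [← ENNReal.div_eq_inv_mul]
      exact ENNReal.div_le_of_le_mul h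
    have hJl : (leftChild J).1 ≤ K + N := by
      simp only [leftChild]; push_cast at hJ; linarith
    have hJr : (rightChild J).1 ≤ K + N := hJl
    rw [dyadicAverage_eq_children] at hF
    obtain ⟨F₁, F₂, hF₁, hF₂, rfl⟩ := exists_coe_of_inv_two_mul_add hF
    have ht' := ht
    rw [dyadicAverage_eq_children] at ht
    obtain ⟨t₁, t₂, ht₁, ht₂, rfl⟩ := exists_coe_of_inv_two_mul_add ht
    obtain ⟨M₁, hM₁⟩ : ∃ M₁ : ℝ≥0, (dyadicLength (leftChild J) : ℝ≥0∞)⁻¹ *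
        sumBelow (fun J => (α J : ℝ≥0∞)) (leftChild J) = M₁ :=
      ⟨_, (ENNReal.coe_toNNReal (ne_top_of_le_ne_top ENNReal.coe_ne_top (hmass _))).symm⟩
    obtain ⟨M₂, hM₂⟩ : ∃ M₂ : ℝ≥0, (dyadicLength (rightChild J) : ℝ≥0∞)⁻¹ *
        sumBelow (fun J => (α J : ℝ≥0∞)) (rightChild J) = M₂ :=
      ⟨_, (ENNReal.coe_toNNReal (ne_top_of_le_ne_top ENNReal.coe_ne_top (hmass _))).symm⟩
    obtain ⟨v₁, hv₁, A₁⟩ := ih _ F₁ t₁ M₁ hJl hF₁ ht₁ hM₁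
    obtain ⟨v₂, hv₂, A₂⟩ := ih _ F₂ t₂ M₂ hJr hF₂ ht₂ hM₂
    have ha : (dyadicLength J : ℝ≥0∞)⁻¹ * α J = (α J / dyadicLength J : ℝ≥0) := by
      rw [ENNReal.coe_div (dyadicLength_pos J).ne', ENNReal.div_eq_inv_mul]
    have hM' : M = α J / dyadicLength J + (M₁ + M₂) / 2 := by
      rw [← ENNReal.coe_inj, ← hM, normalized_sumBelow_eq_children, hM₁, hM₂, ha,
        inv_two_mul_coe_add, ENNReal.coe_add]
    have hMC : α J / dyadicLength J + (M₁ + M₂) / 2 ≤ C := by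
      rw [← hM', ← ENNReal.coe_le_coe, ← hM]; exact hmass J
    refine ⟨_, ?_, hM' ▸ Approximable.node hR hp A₁ A₂ hMC⟩
    rw [normalized_sumBelow_eq_children, hv₁, hv₂, inv_two_mul_coe_add, truncatedTerm, if_pos hK,
      ht', ← mul_assoc, ha, ENNReal.coe_add, ENNReal.coe_mul, ENNReal.coe_rpow_of_nonneg _ hp0.le]

/-- A finite partial sum meets only finitely many scales. -/
lemma sumBelow_le_of_truncated {p : ℝ} {f : ℝ → ℝ≥0} {α : ℤ × ℤ → ℝ≥0} {I : ℤ × ℤ} {b : ℝ≥0∞}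
    (h : ∀ K, sumBelow (truncatedTerm p f α K) I ≤ b) :
    sumBelow (fun J => (α J : ℝ≥0∞) * dyadicAverage (fun x => (f x : ℝ≥0∞)) J ^ p) I ≤ b := by
  rw [sumBelow, ENNReal.tsum_eq_iSup_sum]
  refine iSup_le fun s => ?_
  obtain ⟨K, hK⟩ : ∃ K : ℤ, ∀ J ∈ s, K < J.1.1 := by
    obtain ⟨K, hK⟩ := (s.image fun J => J.1.1).bddBelow
    exact ⟨K - 1, fun J hJ => by
      have := hK (Finset.mem_coe.2 (Finset.mem_image_of_mem (fun J => J.1.1) hJ)); omega⟩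
  calc _ = ∑ J ∈ s, truncatedTerm p f α K J.1 :=
        Finset.sum_congr rfl fun J hJ => (if_pos (hK J hJ)).symm
    _ ≤ sumBelow (truncatedTerm p f α K) I := ENNReal.sum_le_tsum s
    _ ≤ b := h K

/-- To bound the dyadic functional it suffices to bound the values that can be realized
approximately. -/
lemma DyadicAdmissible.dyadicValue_le (hR : IsInfinitelyRefining μ ℱ) (hp : 1 < p) {I : ℤ × ℤ}
    {F t M : ℝ≥0} {f : ℝ → ℝ≥0} {α : ℤ × ℤ → ℝ≥0} (h : DyadicAdmissible p I F t M C f α)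
    {b : ℝ≥0∞} (hb : ∀ v : ℝ≥0, Approximable μ ℱ p C F t M v → (v : ℝ≥0∞) ≤ b) :
    dyadicValue p I f α ≤ b := by
  have hl := coe_dyadicLength_ne_zero I
  rw [dyadicValue, ← ENNReal.div_eq_inv_mul]
  refine ENNReal.div_le_of_le_mul (sumBelow_le_of_truncated fun K => ?_)
  obtain ⟨v, hv, A⟩ := approximable_of_dyadic hR hp h.measurable h.carleson K (I.1 - K).toNat I
    F t M (by omega) h.average_rpow h.average h.mass
  rw [← ENNReal.div_le_iff_le_mul (.inl hl) (.inl ENNReal.coe_ne_top), ENNReal.div_eq_inv_mul, hv]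
  exact hb v A

lemma dyadicAverage_const (c : ℝ≥0∞) (J : ℤ × ℤ) : dyadicAverage (fun _ => c) J = c := by
  rw [dyadicAverage_eq, setLIntegral_const, volume_dyadicInterval, mul_left_comm,
    ENNReal.inv_mul_cancel (coe_dyadicLength_ne_zero J) ENNReal.coe_ne_top, mul_one]

/-- The case of equality in Jensen's inequality. -/
lemma ae_eq_const_of_rpow_eq (hp : 1 < p) {ν : Measure X} [IsFiniteMeasure ν] (hν : ν ≠ 0)
    {f : X → ℝ≥0} (hf : Measurable f) {t : ℝ≥0} (ht : ∫⁻ x, f x ∂ν = t * ν Set.univ)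
    (hF : ∫⁻ x, (f x : ℝ≥0∞) ^ p ∂ν = (t : ℝ≥0∞) ^ p * ν Set.univ) : ∀ᵐ x ∂ν, f x = t := by
  have hp0 : 0 < p := by linarith
  have hνr : ν.real Set.univ ≠ 0 := by
    rw [measureReal_def, ENNReal.toReal_ne_zero]
    exact ⟨by simpa using hν, by finiteness⟩
  have i1 : Integrable (fun x => (f x : ℝ)) ν := by
    refine ⟨hf.coe_nnreal_real.aestronglyMeasurable, ?_⟩
    rw [hasFiniteIntegral_iff_enorm]
    simp only [Real.enorm_eq_ofReal NNReal.zero_le_coe, ENNReal.ofReal_coe_nnreal]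
    rw [ht]; finiteness
  have hrp : ∀ x, ENNReal.ofReal ((f x : ℝ) ^ p) = (f x : ℝ≥0∞) ^ p := fun x => by
    rw [← NNReal.coe_rpow, ENNReal.ofReal_coe_nnreal, ENNReal.coe_rpow_of_nonneg _ hp0.le]
  have hpm : Measurable fun x => (f x : ℝ) ^ p := hf.coe_nnreal_real.pow_const p
  have i2 : Integrable (fun x => (f x : ℝ) ^ p) ν := by
    refine ⟨hpm.aestronglyMeasurable, ?_⟩
    rw [hasFiniteIntegral_iff_ofReal (.of_forall fun x => by positivity)]
    simp_rw [hrp]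
    rw [hF]; finiteness
  have e1 : ⨍ x, (f x : ℝ) ∂ν = t := by
    rw [average_eq, integral_eq_lintegral_of_nonneg_ae (.of_forall fun x => NNReal.coe_nonneg _)
      hf.coe_nnreal_real.aestronglyMeasurable]
    simp only [ENNReal.ofReal_coe_nnreal]
    rw [ht, ENNReal.toReal_mul, ENNReal.coe_toReal, smul_eq_mul, ← measureReal_def]
    field_simp
  have e2 : ⨍ x, (f x : ℝ) ^ p ∂ν = (t : ℝ) ^ p := by
    rw [average_eq, integral_eq_lintegral_of_nonneg_ae (.of_forall fun x => by positivity)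
      hpm.aestronglyMeasurable]
    simp_rw [hrp]
    rw [hF, ENNReal.toReal_mul, ← ENNReal.toReal_rpow, ENNReal.coe_toReal, smul_eq_mul,
      ← measureReal_def]
    field_simp
  -- Strict convexity leaves only two possibilities: a constant function or strict inequality.
  have := (strictConvexOn_rpow hp).ae_eq_const_or_map_average_lt (μ := ν)
    (f := fun x => (f x : ℝ)) (Real.continuous_rpow_const hp0.le).continuousOn isClosed_Ici
    (.of_forall fun x => NNReal.coe_nonneg _) i1 i2
  rw [e1] at this
  rcases this with h | h
  · filter_upwards [h] with x hx
    exact NNReal.coe_injective hx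
  · rw [e2] at h; exact absurd h (lt_irrefl _)

lemma DyadicAdmissible.dyadicValue_eq (hp : 1 < p) {I : ℤ × ℤ} {t M : ℝ≥0} {f : ℝ → ℝ≥0}
    {α : ℤ × ℤ → ℝ≥0} (h : DyadicAdmissible p I (t ^ p) t M C f α) :
    dyadicValue p I f α = M * (t : ℝ≥0∞) ^ p := by
  have hp0 : 0 < p := by linarith
  have hl := coe_dyadicLength_ne_zero I
  set ν := volume.restrict (dyadicInterval I) with hν
  have huniv : ν Set.univ = dyadicLength I := by
    rw [hν, Measure.restrict_apply_univ, volume_dyadicInterval]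
  have hfin : IsFiniteMeasure ν := ⟨by rw [huniv]; exact ENNReal.coe_lt_top⟩
  have avg : ∀ (g : ℝ → ℝ≥0∞) (c : ℝ≥0∞), dyadicAverage g I = c → ∫⁻ x, g x ∂ν = c * ν Set.univ := by
    intro g c hg
    rw [huniv, ← hg, dyadicAverage_eq, mul_comm, ← mul_assoc,
      ENNReal.mul_inv_cancel hl ENNReal.coe_ne_top, one_mul]
  have hae := ae_eq_const_of_rpow_eq hp (ν := ν)
    (by rw [← Measure.measure_univ_ne_zero, huniv]; exact hl)
    h.measurable (avg _ _ h.average)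
    (avg _ _ (by rw [h.average_rpow, ENNReal.coe_rpow_of_nonneg _ hp0.le]))
  have hJ : ∀ J, dyadicInterval J ⊆ dyadicInterval I →
      dyadicAverage (fun x => (f x : ℝ≥0∞)) J = t := by
    intro J hJI
    rw [← dyadicAverage_const t J, dyadicAverage_eq, dyadicAverage_eq]
    congr 1
    refine lintegral_congr_ae ?_
    filter_upwards [ae_restrict_of_ae_restrict_of_subset hJI hae] with x hx
    rw [hx]
  rw [dyadicValue, sumBelow_congr (b := fun J => (α J : ℝ≥0∞) * (t : ℝ≥0∞) ^ p)
    fun J hJI => by rw [hJ J hJI], sumBelow, ENNReal.tsum_mul_right, ← mul_assoc]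
  congr 1
  exact h.mass

end

/-! ### Attaining the constraints exactly: the lower bound -/

section
variable {X : Type*} {m : MeasurableSpace X} {μ : Measure X} [IsProbabilityMeasure μ]
  {ℱ : Filtration ℕ m} {p : ℝ} {C : ℝ≥0}

/-- Split repeatedly and keep a piece that is not null. With `ε` a quarter of the measure, each
piece has at most `1/2 + 1/4 = 3/4` of it. -/
lemma IsInfinitelyRefining.exists_measure_le (hR : IsInfinitelyRefining μ ℱ) {s : ℝ≥0}
    (hs : 0 < s) : ∃ A : Set X, MeasurableSet A ∧ μ A ≠ 0 ∧ μ A ≤ s := by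
  have key : ∀ N : ℕ, ∃ (n : ℕ) (E : Set X), MeasurableSet[ℱ n] E ∧ μ E ≠ 0 ∧
      μ E ≤ ((3 / 4 : ℝ≥0) ^ N : ℝ≥0) := by
    intro N
    induction N with
    | zero => exact ⟨0, Set.univ, MeasurableSet.univ, by simp, by simp⟩
    | succ N ih =>
      obtain ⟨n, E, hE, h0, hle⟩ := ih
      have hμE : ((μ E).toNNReal : ℝ≥0∞) = μ E := ENNReal.coe_toNNReal (by finiteness)
      have hpos : 0 < (μ E).toNNReal / 4 :=
        div_pos (pos_iff_ne_zero.2 (by simp [ENNReal.toNNReal_eq_zero_iff, h0])) (by norm_num)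
      obtain ⟨k, hk, E₁, E₂, hE₁, hE₂, hd, hu, w, w', hw, hw', hww, hε, hG₁, hG₂⟩ :=
        hR.exists_split hpos hE
      have hw0 : Measurable w := hw.mono (ℱ.le n) le_rfl
      have bound : ∀ S : Set X, S ⊆ E → (∀ G : X → ℝ≥0∞, Measurable[ℱ n] G →
          ∫⁻ x in S, G x * w x ∂μ ≤ 2⁻¹ * ∫⁻ x in E, G x ∂μ) →
          μ S ≤ ((3 / 4 : ℝ≥0) ^ (N + 1) : ℝ≥0) := by
        intro S hS hG
        refine (measure_le_half_add hw0 hww hS hε hG).trans ?_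
        rw [← hμE] at hle ⊢
        rw [ENNReal.coe_le_coe] at hle
        have : (2 : ℝ≥0∞)⁻¹ = (2⁻¹ : ℝ≥0) := by
          rw [ENNReal.coe_inv (by norm_num)]; rfl
        rw [this, ← ENNReal.coe_mul, ← ENNReal.coe_add, ENNReal.coe_le_coe, pow_succ']
        refine le_trans (le_of_eq ?_) (mul_le_mul_right hle (3 / 4))
        generalize (μ E).toNNReal = y
        simp only [ENNReal.toNNReal_coe]
        apply NNReal.eq
        push_cast
        ring
      by_cases h1 : μ E₁ = 0
      · refine ⟨k, E₂, hE₂, fun h2 => h0 ?_, bound E₂ (hu ▸ Set.subset_union_right) hG₂⟩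
        rw [← hu]; exact measure_union_null h1 h2
      · exact ⟨k, E₁, hE₁, h1, bound E₁ (hu ▸ Set.subset_union_left) hG₁⟩
  obtain ⟨N, hN⟩ := exists_pow_lt_of_lt_one hs (show (3 / 4 : ℝ≥0) < 1 by
    rw [← NNReal.coe_lt_coe]; push_cast; norm_num)
  obtain ⟨n, E, hE, h0, hle⟩ := key N
  exact ⟨E, ℱ.le n _ hE, h0, hle.trans (by exact_mod_cast hN.le)⟩

/-- A bounded function can be increased so as to attain prescribed values of the integrals of the
function and of its `p`-th power. -/
lemma exists_ge_lintegral_eq (hp : 1 < p)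
    (hA : ∀ s : ℝ≥0, 0 < s → ∃ A : Set X, MeasurableSet A ∧ μ A ≠ 0 ∧ μ A ≤ s)
    {u : X → ℝ≥0} (hu : Measurable u) {K : ℝ≥0} (huK : ∀ x, u x ≤ K) {τ t F : ℝ≥0} (hτ : 0 < τ)
    (ht : ∫⁻ x, u x ∂μ + τ = t) (hF : ∫⁻ x, ((u x + τ : ℝ≥0) : ℝ≥0∞) ^ p ∂μ ≤ F) :
    ∃ g : X → ℝ≥0, Measurable g ∧ (∀ x, u x ≤ g x) ∧ ∫⁻ x, g x ∂μ = t ∧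
      ∫⁻ x, (g x : ℝ≥0∞) ^ p ∂μ = F := by
  have hp0 : 0 < p := by linarith
  have hp1 : 0 < p - 1 := by linarith
  set β₀ : ℝ≥0 := (F / τ) ^ (p - 1)⁻¹ with hβ₀
  -- The missing integral `τ` is to be spread uniformly or concentrated on `A` with height `β = τ /
  -- μ A`. Concentration has `p`-th power integral at least `β ^ (p - 1) * τ`, which is at least `F`
  -- once `β ≥ β₀`. The `+ 1` keeps the denominator positive.
  obtain ⟨A, hAm, hA0, hAs⟩ := hA (τ / (β₀ + 1)) (div_pos hτ (by positivity))
  set a : ℝ≥0 := (μ A).toNNReal with ha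
  have haA : (a : ℝ≥0∞) = μ A := ENNReal.coe_toNNReal (by finiteness)
  have ha0 : a ≠ 0 := by simp [ha, ENNReal.toNNReal_eq_zero_iff, hA0]
  set β : ℝ≥0 := τ / a with hβ
  have hβa : β * a = τ := div_mul_cancel₀ _ ha0
  have hβ₀β : β₀ ≤ β := by
    rw [← haA, ENNReal.coe_le_coe, le_div_iff₀ (by positivity)] at hAs
    rw [hβ, le_div_iff₀ (pos_iff_ne_zero.2 ha0), mul_comm]
    exact le_trans (by gcongr; exact le_self_add) hAs
  have hFβ : F ≤ β ^ p * a := by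
    have h1 : F / τ ≤ β ^ (p - 1) := by
      calc F / τ = β₀ ^ (p - 1) := by
            rw [hβ₀, ← NNReal.rpow_mul, inv_mul_cancel₀ hp1.ne', NNReal.rpow_one]
        _ ≤ β ^ (p - 1) := by gcongr
    have hβ0 : β ≠ 0 := (div_pos hτ (pos_iff_ne_zero.2 ha0)).ne'
    have e : β ^ p = β ^ (p - 1) * β := by
      rw [← NNReal.rpow_add_one hβ0]; congr 1; ring
    rw [e, mul_assoc, hβa, ← div_le_iff₀ hτ]
    exact h1
  -- For `s` in `[0, 1]` the integral of `g s` does not depend on `s`, while that of its `p`-th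
  -- power moves continuously from at most `F` to at least `F`. The intermediate value theorem
  -- selects `s`.
  set g : ℝ≥0 → X → ℝ≥0 := fun s x => u x + (1 - s) * τ + A.indicator (fun _ => s * β) x with hg
  have hgm : ∀ s, Measurable (g s) := fun s =>
    (hu.add_const _).add (measurable_const.indicator hAm)
  have hcont : Continuous fun s : ℝ≥0 => ∫⁻ x, (g s x : ℝ≥0∞) ^ p ∂μ := by
    rw [continuous_iff_continuousAt]
    intro s₀
    refine tendsto_lintegral_filter_of_dominated_convergence
      (fun _ => ((K + τ + (s₀ + 1) * β : ℝ≥0) : ℝ≥0∞) ^ p)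
      (.of_forall fun s => (hgm s).coe_nnreal_ennreal.pow_const p) ?_ ?_ ?_
    · filter_upwards [Iic_mem_nhds (lt_add_one s₀)] with s hs
      refine .of_forall fun x => ?_
      refine ENNReal.rpow_le_rpow (ENNReal.coe_le_coe.2 ?_) hp0.le
      refine add_le_add (add_le_add (huK x) (mul_le_of_le_one_left' tsub_le_self)) ?_
      refine (Set.indicator_le_self' (fun _ _ => zero_le) x).trans ?_
      gcongr
      exact hs
    · rw [lintegral_const, measure_univ, mul_one]
      exact ENNReal.rpow_ne_top_of_nonneg hp0.le ENNReal.coe_ne_top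
    · refine .of_forall fun x => ?_
      have : Continuous fun s : ℝ≥0 => (g s x : ℝ≥0∞) ^ p := by
        refine ENNReal.continuous_rpow_const.comp (ENNReal.continuous_coe.comp ?_)
        refine (continuous_const.add ((continuous_const.sub continuous_id).mul
          continuous_const)).add ?_
        by_cases hx : x ∈ A
        · simp only [hx, Set.indicator_of_mem]; fun_prop
        · simp only [hx, not_false_eq_true, Set.indicator_of_notMem]; fun_prop
      exact this.tendsto s₀
  have h0 : ∫⁻ x, (g 0 x : ℝ≥0∞) ^ p ∂μ ≤ F := by
    refine le_trans (le_of_eq (lintegral_congr fun x => ?_)) hF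
    simp [hg]
  have h1 : (F : ℝ≥0∞) ≤ ∫⁻ x, (g 1 x : ℝ≥0∞) ^ p ∂μ := by
    calc (F : ℝ≥0∞) ≤ ((β ^ p : ℝ≥0) : ℝ≥0∞) * μ A := by
          rw [← haA]; exact_mod_cast hFβ
      _ = ∫⁻ x in A, ((β ^ p : ℝ≥0) : ℝ≥0∞) ∂μ := (setLIntegral_const _ _).symm
      _ ≤ ∫⁻ x in A, (g 1 x : ℝ≥0∞) ^ p ∂μ := by
          refine setLIntegral_mono' hAm fun x hx => ?_
          rw [ENNReal.coe_rpow_of_nonneg _ hp0.le]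
          gcongr
          simp [hg, hx]
      _ ≤ _ := setLIntegral_le_lintegral _ _
  obtain ⟨s, hs, hsF⟩ := intermediate_value_Icc (zero_le (a := (1 : ℝ≥0))) hcont.continuousOn ⟨h0, h1⟩
  refine ⟨g s, hgm s, fun x => by simp only [hg, add_assoc]; exact le_self_add, ?_, hsF⟩
  have e : ∫⁻ x, ((A.indicator (fun _ => s * β) x : ℝ≥0) : ℝ≥0∞) ∂μ = s * τ := by
    rw [← hβa, ENNReal.coe_mul, haA, ← mul_assoc, ← ENNReal.coe_mul, ← setLIntegral_const,
      ← lintegral_indicator hAm]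
    refine lintegral_congr fun x => ?_
    by_cases hx : x ∈ A <;> simp [hx]
  simp only [hg, ENNReal.coe_add, ENNReal.coe_mul]
  rw [lintegral_add_left ((hu.coe_nnreal_ennreal.add_const _)), lintegral_add_right _ measurable_const,
    lintegral_const, measure_univ, mul_one, e, add_assoc, ← add_mul, ← ENNReal.coe_add,
    tsub_add_cancel_of_le hs.2, ENNReal.coe_one, one_mul, ht]

lemma condLExp_tailSum_le {n : ℕ} {α : ℕ → X → ℝ≥0}
    (h : ∀ A, MeasurableSet[ℱ n] A → ∫⁻ x in A, tailSum α n x ∂μ ≤ C * μ A) :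
    ∀ᵐ x ∂μ, (μ⁻[fun y => ∑' k : ℕ, (α (n + k) y : ℝ≥0∞) | ℱ n]) x ≤ C := by
  have hm := ℱ.le n
  refine ae_le_of_ae_le_trim (hm := hm) (f₂ := fun _ => (C : ℝ≥0∞)) ?_
  refine ae_le_of_forall_setLIntegral_le_of_sigmaFinite (measurable_condLExp _ _ _) ?_
  intro s hs _
  rw [setLIntegral_condLExp_trim hm μ _ hs, setLIntegral_const, trim_measurableSet_eq hm hs]
  exact h s hs

lemma lintegral_embeddingSum_le_martingaleBellman {F t M : ℝ≥0} {f : X → ℝ≥0}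
    {α : ℕ → X → ℝ≥0} (hf : Measurable f) (hF : ∫⁻ x, (f x : ℝ≥0∞) ^ p ∂μ = F)
    (ht : ∫⁻ x, (f x : ℝ≥0∞) ∂μ = t) (hM : ∫⁻ x, tailSum α 0 x ∂μ = M)
    (hα : ∀ n, Measurable[ℱ n] (α n))
    (hC : ∀ n A, MeasurableSet[ℱ n] A → ∫⁻ x in A, tailSum α n x ∂μ ≤ C * μ A) :
    ∫⁻ x, embeddingSum μ ℱ p f α x ∂μ ≤ martingaleBellman μ ℱ p F t M C := by
  refine le_sSup ⟨f, α, hf, hF, ht, ?_, ⟨hα, fun n => condLExp_tailSum_le (hC n)⟩, rfl⟩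
  simpa [tailSum] using hM

lemma setLIntegral_le_of_bot (h0 : ℱ 0 = ⊥) {g : X → ℝ≥0∞} {c : ℝ≥0∞} (hg : ∫⁻ x, g x ∂μ ≤ c)
    {A : Set X} (hA : MeasurableSet[ℱ 0] A) : ∫⁻ x in A, g x ∂μ ≤ c * μ A := by
  rw [h0, MeasurableSpace.measurableSet_bot_iff] at hA
  rcases hA with rfl | rfl
  · simp
  · simpa using hg

lemma mul_rpow_le_martingaleBellman (h0 : ℱ 0 = ⊥) (hp : 0 < p) {t M : ℝ≥0} (hM : M ≤ C) :
    M * (t : ℝ≥0∞) ^ p ≤ martingaleBellman μ ℱ p (t ^ p) t M C := by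
  set α : ℕ → X → ℝ≥0 := fun j _ => if j = 0 then M else 0 with hα
  have htail : ∀ x, tailSum α 0 x = M := by
    intro x
    rw [tailSum, tsum_eq_single 0]
    · simp [hα]
    · intro j hj; simp [hα, hj]
  have htail' : ∀ n, n ≠ 0 → ∀ x, tailSum α n x = 0 := by
    intro n hn x
    simp [tailSum, hα, hn]
  have hemb : ∀ x, embeddingSum μ ℱ p (fun _ => t) α x = M * (t : ℝ≥0∞) ^ p := by
    intro x
    rw [embeddingSum, tsum_eq_single 0]
    · rw [condLExp_const (ℱ.le 0)]; simp [hα]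
    · intro j hj; simp [hα, hj]
  have := lintegral_embeddingSum_le_martingaleBellman (μ := μ) (ℱ := ℱ) (p := p) (C := C)
    (F := t ^ p) (t := t) (M := M) (f := fun _ => t) (α := α) measurable_const
    (by simp [ENNReal.coe_rpow_of_nonneg _ hp.le]) (by simp) (by simp [htail])
    (fun n => measurable_const) (by
      intro n A hA
      rcases eq_or_ne n 0 with rfl | hn
      · refine setLIntegral_le_of_bot h0 ?_ hA
        simpa [htail] using hM
      · simp [htail' n hn])
  simpa [hemb] using this

/-- Scaling by `θ` makes the integral fall short of `t`, and `h2` ensures that filling the gap by a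
constant keeps the `p`-th power integral at most `F`. The function can then be increased to satisfy
both constraints, and increasing it only helps the value. -/
lemma Approximant.rpow_mul_le (h0 : ℱ 0 = ⊥) (hp : 1 < p)
    (hA : ∀ s : ℝ≥0, 0 < s → ∃ A : Set X, MeasurableSet A ∧ μ A ≠ 0 ∧ μ A ≤ s)
    {K F t M v δ θ η : ℝ≥0} (hθη : θ + η = 1) (hη : 0 < η) (hM : M ≤ C) {f : X → ℝ≥0}
    {α : ℕ → X → ℝ≥0} (h : Approximant μ ℱ p C 0 Set.univ K F t M v δ f α)
    (h1 : θ * (t + δ) < t) (h2 : θ * (F + δ) + η * (t + δ / η) ^ p ≤ F) :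
    (θ : ℝ≥0∞) ^ p * v ≤ martingaleBellman μ ℱ p F t M C + δ := by
  have hp0 : 0 < p := by linarith
  have hθ1 : θ ≤ 1 := hθη ▸ le_self_add
  have hα0 : ∀ j, Measurable (α j) := fun j => (h.adapted j).mono (ℱ.le j) le_rfl
  have b1 := h.lintegral_le
  have b2 := h.le_lintegral
  have b3 := h.lintegral_rpow_le
  have b4 := h.le_value
  have b5 := h.mass_le (fun _ => 1) measurable_const
  simp only [measure_univ, mul_one, one_mul, Measure.restrict_univ, lintegral_one] at b1 b2 b3 b4 b5
  obtain ⟨T, hT⟩ : ∃ T : ℝ≥0, ∫⁻ x, f x ∂μ = T :=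
    ⟨_, (ENNReal.coe_toNNReal (ne_top_of_le_ne_top (by finiteness) b1)).symm⟩
  obtain ⟨M', hM'⟩ : ∃ M' : ℝ≥0, ∫⁻ x, tailSum α 0 x ∂μ = M' :=
    ⟨_, (ENNReal.coe_toNNReal (ne_top_of_le_ne_top (by finiteness) b5)).symm⟩
  rw [hT] at b1 b2
  norm_cast at b1 b2
  rw [hM', ENNReal.coe_le_coe] at b5
  have hTt : θ * T < t := lt_of_le_of_lt (by gcongr) h1
  obtain ⟨τ, hτ⟩ := exists_add_of_le hTt.le
  have hτ0 : 0 < τ := by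
    rw [pos_iff_ne_zero]; rintro rfl
    rw [add_zero] at hτ; exact hTt.ne' hτ
  have hτle : τ ≤ η * t + δ := by
    have : θ * T + τ ≤ θ * T + (η * t + δ) := by
      calc θ * T + τ = θ * t + η * t := by rw [← hτ, ← add_mul, hθη, one_mul]
        _ ≤ θ * (T + δ) + η * t := by gcongr
        _ ≤ (θ * T + 1 * δ) + η * t := by rw [mul_add]; gcongr
        _ = _ := by ring
    exact le_of_add_le_add_left this
  obtain ⟨g, hgm, hug, hgt, hgF⟩ := exists_ge_lintegral_eq (F := F) (t := t) (τ := τ)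
    (u := fun x => θ * f x) (K := K) hp hA (h.measurable.const_mul θ)
    (fun x => (mul_le_of_le_one_left' hθ1).trans (h.le_bound x)) hτ0
    (by
      push_cast
      rw [lintegral_const_mul _ h.measurable.coe_nnreal_ennreal, hT, hτ]
      push_cast; rfl)
    (by
      -- Convexity applies after writing the constant as `τ = η * (τ / η)`.
      have pt : ∀ x, ((θ * f x + τ : ℝ≥0) : ℝ≥0∞) ^ p ≤
          θ * (f x : ℝ≥0∞) ^ p + (η * (τ / η) ^ p : ℝ≥0) := by
        intro x
        rw [← ENNReal.coe_rpow_of_nonneg _ hp0.le, ← ENNReal.coe_rpow_of_nonneg _ hp0.le]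
        norm_cast
        have := NNReal.rpow_arith_mean_le_arith_mean2_rpow θ η (f x) (τ / η) hθη hp.le
        rwa [mul_div_cancel₀ _ hη.ne'] at this
      refine (lintegral_mono pt).trans ?_
      rw [lintegral_add_right _ measurable_const, lintegral_const, measure_univ, mul_one,
        lintegral_const_mul _ (h.measurable.coe_nnreal_ennreal.pow_const p)]
      calc _ ≤ θ * ((F : ℝ≥0∞) + δ) + (η * (t + δ / η) ^ p : ℝ≥0) := by
            gcongr
            rw [div_le_iff₀ hη, add_mul, div_mul_cancel₀ _ hη.ne', mul_comm t]
            exact hτle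
        _ ≤ F := by exact_mod_cast h2)
  obtain ⟨d, hd⟩ := exists_add_of_le b5
  -- The missing mass `d` goes to time `0`. It affects only the Carleson condition there, which for
  -- the trivial `ℱ 0` reduces to `M ≤ C`.
  set α' : ℕ → X → ℝ≥0 := fun j x => α j x + if j = 0 then d else 0 with hα'
  have htail0 : ∀ x, tailSum α' 0 x = tailSum α 0 x + d := by
    intro x
    simp only [tailSum, hα', zero_add]
    push_cast
    rw [ENNReal.tsum_add]
    congr 1
    rw [tsum_eq_single 0]
    · simp
    · intro j hj; simp [hj]
  have htail : ∀ n, n ≠ 0 → ∀ x, tailSum α' n x = tailSum α n x := by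
    intro n hn x
    simp [tailSum, hα', hn]
  have hmass : ∫⁻ x, tailSum α' 0 x ∂μ = M := by
    simp_rw [htail0]
    rw [lintegral_add_right _ measurable_const, hM', lintegral_const, measure_univ, mul_one, hd,
      ENNReal.coe_add]
  have hadapted : ∀ n, Measurable[ℱ n] (α' n) := by
    intro n
    refine Measurable.add (h.adapted n) ?_
    exact measurable_const
  have hle := lintegral_embeddingSum_le_martingaleBellman (μ := μ) (ℱ := ℱ) (C := C) hgm hgF hgt
    hmass hadapted (by
      intro n A hA
      rcases eq_or_ne n 0 with rfl | hn
      · refine setLIntegral_le_of_bot h0 ?_ hA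
        rw [hmass]; exact_mod_cast hM
      · have hA' := ℱ.le n _ hA
        have hind : Measurable[ℱ n] (A.indicator (1 : X → ℝ≥0∞)) := by
          refine Measurable.indicator ?_ hA
          exact measurable_const
        have := h.carleson n (A.indicator 1)
          (by rw [max_eq_right n.zero_le]; exact hind)
        simp only [Measure.restrict_univ, lintegral_indicator_one hA'] at this
        simp_rw [htail n hn]
        refine le_trans (le_of_eq ?_) this
        rw [← lintegral_indicator hA']
        refine lintegral_congr fun x => ?_
        by_cases hx : x ∈ A <;> simp [hx])
  have hemb : (θ : ℝ≥0∞) ^ p * ∫⁻ x, embeddingSum μ ℱ p f α x ∂μ ≤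
      ∫⁻ x, embeddingSum μ ℱ p g α' x ∂μ := by
    rw [← lintegral_const_mul _ (measurable_embeddingSum μ ℱ p f hα0)]
    refine lintegral_mono_ae ?_
    have hc : ∀ᵐ x ∂μ, ∀ j, θ * (μ⁻[fun y => (f y : ℝ≥0∞) | ℱ j]) x ≤
        (μ⁻[fun y => (g y : ℝ≥0∞) | ℱ j]) x := by
      rw [ae_all_iff]
      intro j
      have k1 := condLExp_smul_le (mΩ := ℱ j) (P := μ) (fun y => (f y : ℝ≥0∞)) (c := (θ : ℝ≥0∞))
      have k2 := condLExp_mono (mΩ := ℱ j) (P := μ) (X := (θ : ℝ≥0∞) • fun y => (f y : ℝ≥0∞))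
        (Y := fun y => (g y : ℝ≥0∞)) (.of_forall fun x => by
          have := ENNReal.coe_le_coe.2 (hug x)
          rwa [ENNReal.coe_mul] at this)
      filter_upwards [k1, k2] with x k1 k2
      exact k1.trans k2
    filter_upwards [hc] with x hx
    rw [embeddingSum, ← ENNReal.tsum_mul_left, embeddingSum]
    refine ENNReal.tsum_le_tsum fun j => ?_
    calc (θ : ℝ≥0∞) ^ p * (α j x * (μ⁻[fun y => (f y : ℝ≥0∞) | ℱ j]) x ^ p)
        = α j x * (θ * (μ⁻[fun y => (f y : ℝ≥0∞) | ℱ j]) x) ^ p := by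
          rw [ENNReal.mul_rpow_of_nonneg _ _ hp0.le]; ring
      _ ≤ _ := by
          gcongr
          · simp [hα']
          · exact hx j
  calc (θ : ℝ≥0∞) ^ p * v ≤ (θ : ℝ≥0∞) ^ p * (∫⁻ x, embeddingSum μ ℱ p f α x ∂μ + δ) := by gcongr
    _ ≤ martingaleBellman μ ℱ p F t M C + 1 * δ := by
        rw [mul_add]
        gcongr
        · exact hemb.trans hle
        · exact ENNReal.rpow_le_one (by exact_mod_cast hθ1) hp0.le
    _ = _ := by rw [one_mul]

/-- For a fixed `θ < 1` the strict inequalities `0 < t` and `t ^ p < F` make both smallness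
conditions hold for all small `δ`. Hence `δ → 0` comes first and `θ → 1` afterwards. -/
lemma Approximable.le_martingaleBellman (h0 : ℱ 0 = ⊥) (hR : IsInfinitelyRefining μ ℱ)
    (hp : 1 < p) {F t M v : ℝ≥0} (ht : 0 < t) (htF : t ^ p < F) (hM : M ≤ C)
    (h : Approximable μ ℱ p C F t M v) : (v : ℝ≥0∞) ≤ martingaleBellman μ ℱ p F t M C := by
  have hp0 : 0 < p := by linarith
  obtain ⟨K, h⟩ := h
  have key : ∀ θ : ℝ≥0, θ < 1 → (θ : ℝ≥0∞) ^ p * v ≤ martingaleBellman μ ℱ p F t M C := by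
    intro θ hθ
    obtain ⟨η, hη⟩ := exists_add_of_le hθ.le
    have hη0 : 0 < η := by
      rw [pos_iff_ne_zero]; rintro rfl
      rw [add_zero] at hη; exact hθ.ne' hη
    have c1 : Continuous fun δ : ℝ≥0 => θ * (t + δ) := by fun_prop
    have c2 : Continuous fun δ : ℝ≥0 => θ * (F + δ) + η * (t + δ / η) ^ p := by
      have : Continuous fun δ : ℝ≥0 => (t + δ / η) ^ p :=
        (NNReal.continuous_rpow_const hp0.le).comp (by fun_prop)
      fun_prop
    have e1 : ∀ᶠ δ in nhdsWithin (0 : ℝ≥0) (Set.Ioi 0), θ * (t + δ) < t := by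
      refine nhdsWithin_le_nhds (c1.tendsto 0 |>.eventually_lt_const ?_)
      simpa using mul_lt_of_lt_one_left ht hθ
    have e2 : ∀ᶠ δ in nhdsWithin (0 : ℝ≥0) (Set.Ioi 0),
        θ * (F + δ) + η * (t + δ / η) ^ p < F := by
      refine nhdsWithin_le_nhds (c2.tendsto 0 |>.eventually_lt_const ?_)
      simp only [add_zero, zero_div]
      calc θ * F + η * t ^ p < θ * F + η * F := by gcongr
        _ = F := by rw [← add_mul, ← hη, one_mul]
    have lim : Filter.Tendsto (fun δ : ℝ≥0 => martingaleBellman μ ℱ p F t M C + (δ : ℝ≥0∞))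
        (nhdsWithin 0 (Set.Ioi 0)) (nhds (martingaleBellman μ ℱ p F t M C + ((0 : ℝ≥0) : ℝ≥0∞))) :=
      (tendsto_const_nhds.add (ENNReal.continuous_coe.tendsto 0)).mono_left nhdsWithin_le_nhds
    have := ge_of_tendsto lim (b := (θ : ℝ≥0∞) ^ p * v) (by
      filter_upwards [e1, e2, self_mem_nhdsWithin] with δ h1 h2 hδ
      obtain ⟨f, α, H⟩ := h 0 Set.univ MeasurableSet.univ δ hδ
      exact H.rpow_mul_le h0 hp (fun s hs => hR.exists_measure_le hs) hη.symm hη0 hM h1 h2.le)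
    simpa using this
  have lim : Filter.Tendsto (fun θ : ℝ≥0 => (θ : ℝ≥0∞) ^ p * v)
      (nhdsWithin 1 (Set.Iio 1)) (nhds (((1 : ℝ≥0) : ℝ≥0∞) ^ p * v)) := by
    refine ENNReal.Tendsto.mul_const ?_ (.inr ENNReal.coe_ne_top)
    exact ((ENNReal.continuous_rpow_const.comp ENNReal.continuous_coe).tendsto 1).mono_left
      nhdsWithin_le_nhds
  have hne : (nhdsWithin (1 : ℝ≥0) (Set.Iio 1)).NeBot := nhdsLT_neBot_of_exists_lt ⟨0, zero_lt_one⟩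
  have := le_of_tendsto lim (eventually_nhdsWithin_of_forall fun θ hθ => key θ hθ)
  simpa using this

theorem dyadicBellman_le_martingaleBellman (h0 : ℱ 0 = ⊥) (hR : IsInfinitelyRefining μ ℱ)
    (hp : 1 < p) (I : ℤ × ℤ) (F t M C : ℝ≥0) :
    dyadicBellman p I F t M C ≤ martingaleBellman μ ℱ p F t M C := by
  have hp0 : 0 < p := by linarith
  refine dyadicBellman_le fun f α h => ?_
  have hM : M ≤ C := by
    have hc := h.carleson I
    rw [volume_dyadicInterval] at hc
    rw [← ENNReal.coe_le_coe, ← h.mass, ← ENNReal.div_eq_inv_mul]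
    exact ENNReal.div_le_of_le_mul hc
  have htF := rpow_dyadicAverage_le hp h.measurable h.average_rpow h.average
  rcases htF.lt_or_eq with hlt | rfl
  -- If `t = 0`, then `f` vanishes almost everywhere on `I` and `F = 0`, contrary to the strict
  -- inequality.
  · have ht : 0 < t := by
      rw [pos_iff_ne_zero]
      rintro rfl
      have hav := h.average
      have hl : (dyadicLength I : ℝ≥0∞)⁻¹ ≠ 0 := ENNReal.inv_ne_zero.2 ENNReal.coe_ne_top
      rw [dyadicAverage_eq, ENNReal.coe_zero, mul_eq_zero, or_iff_right hl,
        lintegral_eq_zero_iff h.measurable.coe_nnreal_ennreal] at hav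
      have hF := h.average_rpow
      rw [dyadicAverage_eq, lintegral_congr_ae (g := fun _ => 0) (by
        filter_upwards [hav] with x hx
        simp only [Pi.zero_apply] at hx
        simp [hx, hp0]), lintegral_zero, mul_zero] at hF
      have : F = 0 := by exact_mod_cast hF.symm
      simp [this] at hlt
    exact h.dyadicValue_le hR hp fun v hv => hv.le_martingaleBellman h0 hR hp ht hlt hM
  · rw [h.dyadicValue_eq hp]
    exact mul_rpow_le_martingaleBellman h0 hp0 hM

end

end CarlesonBellman

theorem theoremA {X : Type*} {m : MeasurableSpace X} (μ : Measure X) [IsProbabilityMeasure μ]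
    (ℱ : Filtration ℕ m) (hℱ : ℱ 0 = ⊥) (p : ℝ) (hp : 1 < p) :
    (∀ (I : ℤ × ℤ) (F t M C : ℝ≥0),
      CarlesonBellman.martingaleBellman μ ℱ p F t M C ≤
        CarlesonBellman.dyadicBellman p I F t M C) ∧
    (CarlesonBellman.IsInfinitelyRefining μ ℱ →
      ∀ (I : ℤ × ℤ) (F t M C : ℝ≥0),
        CarlesonBellman.martingaleBellman μ ℱ p F t M C =
          CarlesonBellman.dyadicBellman p I F t M C) :=
  ⟨fun I F t M C => CarlesonBellman.martingaleBellman_le_dyadicBellman μ ℱ hp I F t M C,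
    fun hR I F t M C => le_antisymm
      (CarlesonBellman.martingaleBellman_le_dyadicBellman μ ℱ hp I F t M C)
      (CarlesonBellman.dyadicBellman_le_martingaleBellman hℱ hR hp I F t M C)⟩
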